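/- Let $V$ be a finite-dimensional Euclidean space and let $W$ be a finite group of isometries of $V$, generated by reflections and acting essentially. Fix a fundamental chamber of $W$, let $S$ be the set of reflections in its walls, and for $s \in S$ let the simple root $\alpha_s$ be an inward normal vector (of arbitrary length) to the wall of $s$; the $\alpha_s$ form a basis of $V$. Let $(\omega_s)_{s \in S}$ be the fundamental weights, defined by $\langle \alpha_s, \omega_t\rangle = \delta_{s=t}\langle \alpha_s,\alpha_s\rangle/2$. Let $\ell$ be the length function on $W$ with respect to $S$ and let $w_\circ$ be the longest element of $W$. Let $Q = q_1 \cdots q_m$ be a word on $S$ whose Demazure product is $w_\circ$, where the Demazure product $\delta$ is defined inductively by $\delta(\varepsilon) = e$ and $\delta(Q's) = ws$ if $\ell(ws) = \ell(w)+1$ and $\delta(Q's) = w$ otherwise, with $w = \delta(Q')$. The subword complex $\mathcal{S}(Q)$ is the simplicial complex of all sets $I \subseteq [m]$ of positions such that $[m] \setminus I$ contains the positions of a reduced expression of $w_\circ$. For a facet $I$ of $\mathcal{S}(Q)$ and $k \in [m]$, let $\sigma_I^{[1,k-1]}$ be the product, from left to right, of the $q_z$ with $1 \le z \le k-1$, $z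 \notin I$, and put $$r(I,k) = \sigma_I^{[1,k-1]}(\alpha_{q_k}), \qquad w(I,k) = \sigma_I^{[1,k-1]}(\omega_{q_k}).$$ Assume that $Q$ is realizing: for every facet $I$, the family $(r(I,i))_{i \in I}$ is a basis of $V$. Define the brick polytope $\mathcal{B}(Q) = \operatorname{conv}\{\sum_{k=1}^m w(I,k) : I \text{ facet of } \mathcal{S}(Q)\}$ and, for $k \in [m]$, the polytope $\mathcal{B}(Q,k) = \operatorname{conv}\{w(I,k) : I \text{ facet of } \mathcal{S}(Q)\}$. Then $\mathcal{B}(Q)$ is the Minkowski sum of the polytopes $\mathcal{B}(Q,k)$, $$\mathcal{B}(Q) = \sum_{k=1}^m \mathcal{B}(Q,k),$$ that is, the convex hull and the sum in the definition of $\mathcal{B}(Q)$ commute. Moreover, each $\mathcal{B}(Q,k)$ is a $W$-matroid polytope: a (nonempty) polytope such that the group generated by the mirror symmetries of its edges (the affine reflections exchanging the two endpoints of an edge) is a subgroup of $W$. -/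

import Mathlib

open scoped Pointwise RealInnerProductSpace

namespace BrickPolytope

variable {V : Type*} [NormedAddCommGroup V] [InnerProductSpace ℝ V]

/-- The orthogonal reflection `s_v`, sending `v` to `-v` and fixing the hyperplane orthogonal
to `v` pointwise. -/
noncomputable def refl (v : V) : V ≃ₗᵢ[ℝ] V := (ℝ ∙ v)ᗮ.reflection

/-- A finite Coxeter group acting on `V`: a finite group of isometries of `V` which is generated
by the reflections it contains. -/
structure IsFiniteReflectionGroup (W : Subgroup (V ≃ₗᵢ[ℝ] V)) : Prop where
  finite : Finite W
  generated : Subgroup.closure {g | g ∈ W ∧ ∃ v : V, v ≠ 0 ∧ g = refl v} = W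

variable {S : Type*}

/-- The basis `α` of `V` is a system of simple roots of `W`, for the fundamental chamber
`{x | ∀ s, 0 ≤ ⟪α s, x⟫}`. This cone is a chamber with the `α s` as inward facet normals when
the hyperplanes orthogonal to the `α s` are reflecting hyperplanes of `W` while no reflecting
hyperplane of `W` meets the interior of the cone. The lengths of the `α s` are free, as is the
choice of a generalized Cartan matrix. -/
structure IsSimpleSystem (W : Subgroup (V ≃ₗᵢ[ℝ] V)) (α : Module.Basis S ℝ V) : Prop where
  refl_mem : ∀ s, refl (α s) ∈ W
  chamber : ∀ v : V, v ≠ 0 → refl v ∈ W → ∀ x : V, (∀ s, 0 < ⟪α s, x⟫) → ⟪v, x⟫ ≠ 0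

section Words

variable (α : Module.Basis S ℝ V)

/-- The group element represented by a word on the simple reflections. -/
noncomputable def wordProd (l : List S) : V ≃ₗᵢ[ℝ] V := (l.map fun s => refl (α s)).prod

/-- The length of an element with respect to the simple reflections. -/
noncomputable def len (w : V ≃ₗᵢ[ℝ] V) : ℕ :=
  sInf {p | ∃ l : List S, wordProd α l = w ∧ l.length = p}

/-- `w` is a longest element of `W`. -/
def IsLongest (W : Subgroup (V ≃ₗᵢ[ℝ] V)) (w : V ≃ₗᵢ[ℝ] V) : Prop :=
  w ∈ W ∧ ∀ u ∈ W, len α u ≤ len α w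

/-- The Demazure product of a word. -/
noncomputable def demazure (l : List S) : V ≃ₗᵢ[ℝ] V :=
  l.foldl (fun w s => if len α (w * refl (α s)) = len α w + 1 then w * refl (α s) else w) 1

variable {m : ℕ} (Q : Fin m → S)

/-- The product, from left to right, of the letters of `Q` at the positions in `J`. -/
noncomputable def subwordProd (J : Finset (Fin m)) : V ≃ₗᵢ[ℝ] V :=
  wordProd α (((List.finRange m).filter (· ∈ J)).map Q)

/-- `I` is a face of the subword complex of `Q` and `ρ`: the complement of `I` contains the set
of positions of a reduced expression of `ρ`. -/
def IsFace (ρ : V ≃ₗᵢ[ℝ] V) (I : Finset (Fin m)) : Prop :=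
  ∃ J : Finset (Fin m), J ⊆ Iᶜ ∧ subwordProd α Q J = ρ ∧ J.card = len α ρ

/-- The facets of the subword complex of `Q` and `ρ` are its maximal faces. -/
def IsFacet (ρ : V ≃ₗᵢ[ℝ] V) (I : Finset (Fin m)) : Prop := Maximal (IsFace α Q ρ) I

/-- The product of the letters at the positions before `k` which are not in `I`. -/
noncomputable def prefixProd (I : Finset (Fin m)) (k : Fin m) : V ≃ₗᵢ[ℝ] V :=
  subwordProd α Q (Finset.Iio k \ I)

/-- The root function of `I`. -/
noncomputable def root (I : Finset (Fin m)) (k : Fin m) : V := prefixProd α Q I k (α (Q k))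

/-- `Q` is realizing: the root configuration of each facet is a linear basis of `V`. -/
def IsRealizing (ρ : V ≃ₗᵢ[ℝ] V) : Prop :=
  ∀ I, IsFacet α Q ρ I → LinearIndependent ℝ (fun i : I => root α Q I i) ∧
    Submodule.span ℝ (Set.range fun i : I => root α Q I i) = ⊤

variable [FiniteDimensional ℝ V]

/-- The fundamental weights: up to the factor `⟪α s, α s⟫ / 2`, the dual basis of `α` with respect
to the inner product. -/
noncomputable def weight (s : S) : V :=
  haveI := FiniteDimensional.complete ℝ V
  (⟪α s, α s⟫ / 2) • (InnerProductSpace.toDual ℝ V).symm (α.coord s).toContinuousLinearMap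

theorem inner_weight [DecidableEq S] (s t : S) :
    ⟪α s, weight α t⟫ = if s = t then ⟪α s, α s⟫ / 2 else 0 := by
  have := FiniteDimensional.complete ℝ V
  rw [real_inner_comm, weight, real_inner_smul_left, InnerProductSpace.toDual_symm_apply]
  by_cases h : s = t
  · subst h; simp
  · simp [h]

/-- The weight function of `I`. -/
noncomputable def weightFun (I : Finset (Fin m)) (k : Fin m) : V :=
  prefixProd α Q I k (weight α (Q k))

/-- The brick vector of `I`. -/
noncomputable def brickVector (I : Finset (Fin m)) : V := ∑ k, weightFun α Q I k

/-- The brick polytope. -/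
noncomputable def brickPolytope (ρ : V ≃ₗᵢ[ℝ] V) : Set V :=
  convexHull ℝ {x | ∃ I, IsFacet α Q ρ I ∧ x = brickVector α Q I}

/-- The convex hull of the weights at position `k` of all facets. -/
noncomputable def brickSummand (ρ : V ≃ₗᵢ[ℝ] V) (k : Fin m) : Set V :=
  convexHull ℝ {x | ∃ I, IsFacet α Q ρ I ∧ x = weightFun α Q I k}

end Words

/-- `P` is a (nonempty convex) polytope. -/
def IsPolytope (P : Set V) : Prop := ∃ F : Finset V, F.Nonempty ∧ P = convexHull ℝ (F : Set V)

/-- The segment from `a` to `b` is an edge of `P`, that is, a one-dimensional face. -/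
def IsEdge (P : Set V) (a b : V) : Prop := a ≠ b ∧ IsExposed ℝ P (segment ℝ a b)

variable [FiniteDimensional ℝ V]

/-- The mirror symmetry of the segment from `a` to `b`: the affine reflection in its perpendicular
bisector. -/
noncomputable def mirror (a b : V) : V ≃ᵃⁱ[ℝ] V :=
  haveI : Nonempty (AffineSubspace.perpBisector a b) :=
    ⟨⟨midpoint ℝ a b, AffineSubspace.midpoint_mem_perpBisector a b⟩⟩
  EuclideanGeometry.reflection (AffineSubspace.perpBisector a b)

/-- A `W`-matroid polytope: a polytope such that the group generated by the mirror symmetries of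
its edges is a subgroup of `W`. -/
def IsMatroidPolytope (W : Subgroup (V ≃ₗᵢ[ℝ] V)) (P : Set V) : Prop :=
  IsPolytope P ∧
    ∀ g ∈ Subgroup.closure {g : V ≃ᵃⁱ[ℝ] V | ∃ a b, IsEdge P a b ∧ g = mirror a b},
      ∃ w ∈ W, g = w.toAffineIsometryEquiv

end BrickPolytope

/-! Fix `f` off all reflecting hyperplanes and call a facet optimal when `f` is positive on its
roots. Outside a facet `I` every reflection of `W` occurs exactly once as the reflection of a root,
so each position `i` of `I` can be flipped. The flip shifts every weight `w(I,k)` by a nonnegative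
multiple of `-r(I,i)`, the sign being the same for all `k` (`IsFlip.exists_weightFun_eq`). If `f` is
negative on `r(I,i)`, no weight decreases along `f` and the brick vector strictly increases
(`IsFacet.exists_improvement`).

For realizing `Q` the optimal facet is unique (`IsOptimal.unique`). Indeed the roots positive on `f`
are those in `w(Φ⁺)` for some `w` in `W`, and at most one facet has all its roots there
(`RootsIn.unique`). For `w₀` it can only be the greedy facet. Crossing the wall between the chambers
of `w` and `ws` amounts to flipping the position whose root is proportional to `w(α_s)`, if there is
one; independence of the roots leaves at most one. Hence a single facet maximizes `f` on all the
weights simultaneously, support functions add up in generic directions, and separation with a small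
perturbation gives the Minkowski sum.

For an edge from `a` to `b` of a summand, perturb the exposing functional to a generic one favouring
`b`. No facet with weight `a` is optimal, so some improving flip moves the weight away from `a`
along a root, without leaving the edge. Thus `b - a` is proportional to a root. As `a` and `b` lie
in one `W`-orbit, their norms agree and the mirror symmetry is the linear reflection in that root.
-/

namespace BrickPolytope

variable {V : Type*} [NormedAddCommGroup V] [InnerProductSpace ℝ V]

/-! ### Reflections -/

theorem refl_apply (v x : V) : refl v x = x - (2 * ⟪v, x⟫ / ‖v‖ ^ 2) • v := by
  rw [refl, Submodule.reflection_orthogonal_apply, Submodule.reflection_singleton_apply, neg_sub,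
    ← Nat.cast_smul_eq_nsmul ℝ, smul_smul]
  congr 2
  simp [mul_div_assoc]

theorem refl_self (v : V) : refl v v = -v := by
  rw [refl]; exact Submodule.reflection_orthogonalComplement_singleton_eq_neg v

theorem refl_mul_self (v : V) : refl v * refl v = 1 := by
  rw [refl]; exact Submodule.reflection_mul_reflection _

theorem refl_inv (v : V) : (refl v)⁻¹ = refl v := by
  rw [refl]; exact Submodule.reflection_inv

theorem refl_refl (v x : V) : refl v (refl v x) = x := by
  rw [refl]; exact Submodule.reflection_reflection _ _

theorem refl_smul {c : ℝ} (hc : c ≠ 0) (v : V) : refl (c • v) = refl v := by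
  have : (ℝ ∙ (c • v)) = ℝ ∙ v := Submodule.span_singleton_smul_eq (IsUnit.mk0 c hc) v
  unfold refl
  congr 2

theorem refl_neg (v : V) : refl (-v) = refl v := by
  simpa using refl_smul (c := -1) (by norm_num) v

theorem exists_smul_of_refl_eq {v w : V} (hw : w ≠ 0) (h : refl v = refl w) :
    ∃ c : ℝ, c ≠ 0 ∧ w = c • v := by
  have h1 := refl_self w
  rw [← h, refl_apply] at h1
  have h2 : w = (⟪v, w⟫ / ‖v‖ ^ 2) • v := by
    have h3 : (2 : ℝ) • w = (2 * ⟪v, w⟫ / ‖v‖ ^ 2) • v := by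
      rw [two_smul]
      simpa using congrArg (w + ·) (sub_eq_iff_eq_add.1 h1)
    rw [mul_div_assoc, mul_smul] at h3
    exact smul_right_injective V (two_ne_zero (α := ℝ)) h3
  refine ⟨_, fun h0 => hw ?_, h2⟩
  rw [h2, h0, zero_smul]

theorem mul_apply (g h : V ≃ₗᵢ[ℝ] V) (x : V) : (g * h) x = g (h x) := rfl

theorem inv_apply_self (g : V ≃ₗᵢ[ℝ] V) (x : V) : g⁻¹ (g x) = x := g.symm_apply_apply x

theorem apply_inv_self (g : V ≃ₗᵢ[ℝ] V) (x : V) : g (g⁻¹ x) = x := g.apply_symm_apply x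

theorem refl_map (g : V ≃ₗᵢ[ℝ] V) (v : V) : refl (g v) = g * refl v * g⁻¹ := by
  ext x
  rw [mul_apply, mul_apply, refl_apply, refl_apply, map_sub, apply_inv_self, map_smul,
    g.norm_map]
  congr 4
  rw [← g.inner_map_map v, apply_inv_self]

/-- A nonzero vector orthogonal to a reflecting hyperplane of `W`. -/
def IsRoot (W : Subgroup (V ≃ₗᵢ[ℝ] V)) (v : V) : Prop := v ≠ 0 ∧ refl v ∈ W

/-! ### Positive roots, length and the longest element -/

section Roots

variable {W : Subgroup (V ≃ₗᵢ[ℝ] V)}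

theorem IsRoot.neg {v : V} (h : IsRoot W v) : IsRoot W (-v) :=
  ⟨neg_ne_zero.2 h.1, by rw [refl_neg]; exact h.2⟩

theorem IsRoot.map {v : V} (h : IsRoot W v) {g : V ≃ₗᵢ[ℝ] V} (hg : g ∈ W) :
    IsRoot W (g v) :=
  ⟨by simpa using h.1, by rw [refl_map]; exact W.mul_mem (W.mul_mem hg h.2) (W.inv_mem hg)⟩

variable {S : Type*} {α : Module.Basis S ℝ V}

/-- A nonzero vector with nonnegative coordinates. -/
def IsPos (α : Module.Basis S ℝ V) (v : V) : Prop := v ≠ 0 ∧ ∀ s, 0 ≤ α.repr v s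

theorem IsPos.not_neg {v : V} (h : IsPos α v) : ¬ IsPos α (-v) := by
  intro h'
  refine h.1 (α.ext_elem fun s => ?_)
  have h1 := h.2 s
  have h2 := h'.2 s
  simp only [map_neg, Finsupp.coe_neg, Pi.neg_apply] at h2
  simp only [map_zero, Finsupp.coe_zero, Pi.zero_apply]
  linarith

theorem IsPos.smul {v : V} (h : IsPos α v) {c : ℝ} (hc : 0 < c) : IsPos α (c • v) :=
  ⟨smul_ne_zero hc.ne' h.1, fun s => by simpa using mul_nonneg hc.le (h.2 s)⟩

theorem isPos_simple (s : S) : IsPos α (α s) := by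
  classical
  refine ⟨α.ne_zero s, fun t => ?_⟩
  rw [α.repr_self, Finsupp.single_apply]
  split_ifs <;> norm_num

theorem IsPos.pos_of_eq_smul {v w : V} (hv : IsPos α v) (hw : IsPos α w) {c : ℝ}
    (h : w = c • v) : 0 < c := by
  rcases lt_trichotomy c 0 with hc | hc | hc
  · refine absurd ?_ hw.not_neg
    rw [h, ← neg_smul]
    exact hv.smul (by linarith)
  · exact absurd (by rw [h, hc, zero_smul]) hw.1
  · exact hc

theorem isRoot_simple (hα : IsSimpleSystem W α) (s : S) : IsRoot W (α s) :=
  ⟨α.ne_zero s, hα.refl_mem s⟩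

theorem repr_refl_simple_of_ne {s t : S} (h : t ≠ s) (v : V) :
    α.repr (refl (α s) v) t = α.repr v t := by
  classical
  rw [refl_apply]
  simp [h.symm]

theorem wordProd_nil : wordProd α [] = 1 := rfl

theorem wordProd_append (l l' : List S) :
    wordProd α (l ++ l') = wordProd α l * wordProd α l' := by simp [wordProd]

theorem wordProd_cons (s : S) (l : List S) :
    wordProd α (s :: l) = refl (α s) * wordProd α l := by simp [wordProd]

theorem wordProd_singleton (s : S) : wordProd α [s] = refl (α s) := by simp [wordProd]

theorem wordProd_mem (hα : IsSimpleSystem W α) (l : List S) : wordProd α l ∈ W := by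
  induction l with
  | nil => exact W.one_mem
  | cons s l ih => rw [wordProd_cons]; exact W.mul_mem (hα.refl_mem s) ih

theorem wordProd_reverse (l : List S) : wordProd α l.reverse = (wordProd α l)⁻¹ := by
  induction l with
  | nil => simp [wordProd_nil]
  | cons s l ih =>
    rw [List.reverse_cons, wordProd_append, ih, wordProd_singleton, wordProd_cons, mul_inv_rev,
      refl_inv]

theorem len_wordProd_le (l : List S) : len α (wordProd α l) ≤ l.length :=
  Nat.sInf_le ⟨l, rfl, rfl⟩

variable [FiniteDimensional ℝ V]

theorem exists_inner_simple_eq (α : Module.Basis S ℝ V) (y : S → ℝ) :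
    ∃ x : V, ∀ v, ⟪v, x⟫ = α.constr ℝ y v := by
  have := FiniteDimensional.complete ℝ V
  refine ⟨(InnerProductSpace.toDual ℝ V).symm (α.constr ℝ y).toContinuousLinearMap, fun v => ?_⟩
  rw [real_inner_comm, InnerProductSpace.toDual_symm_apply]
  simp

/-- With coordinates of both signs, `v` would vanish somewhere in the open chamber: start at the
point pairing to 1 with all simple roots and raise one of these pairings until `v` pairs to zero. -/
theorem IsRoot.pos_or_neg (hα : IsSimpleSystem W α) {v : V} (hv : IsRoot W v) :
    IsPos α v ∨ IsPos α (-v) := by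
  classical
  have := Module.Finite.finite_basis α
  have := Fintype.ofFinite S
  by_contra! hcon
  obtain ⟨h1, h2⟩ := hcon
  have h1 : ∃ t, α.repr v t < 0 := by
    by_contra! h; exact h1 ⟨hv.1, h⟩
  have h2 : ∃ s, 0 < α.repr v s := by
    by_contra! h; exact h2 ⟨neg_ne_zero.2 hv.1, fun s => by simpa using h s⟩
  obtain ⟨t, ht⟩ := h1
  obtain ⟨s, hs⟩ := h2
  have key : ∀ y : S → ℝ, (∀ u, 0 < y u) → ∑ u, α.repr v u * y u ≠ 0 := by
    intro y hy h0
    obtain ⟨x, hx⟩ := exists_inner_simple_eq α y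
    refine hα.chamber v hv.1 hv.2 x (fun u => ?_) ?_
    · rw [hx, α.constr_basis]; exact hy u
    · rw [hx, Module.Basis.constr_apply_fintype, ← h0]; simp
  set T := ∑ u, α.repr v u with hT
  have bump : ∀ r : S, ∀ a : ℝ, 0 ≤ a → T + α.repr v r * a ≠ 0 := by
    intro r a ha h0
    refine key (fun u => 1 + if u = r then a else 0) (fun u => ?_) ?_
    · split_ifs <;> linarith
    · simp only [mul_add, mul_one, Finset.sum_add_distrib, mul_ite, mul_zero,
        Finset.sum_ite_eq', Finset.mem_univ, if_true]
      exact h0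
  rcases le_total 0 T with h | h
  · refine bump t (T / -(α.repr v t)) (div_nonneg h (by linarith)) ?_
    have := ht.ne
    field_simp
    ring
  · refine bump s (-T / (α.repr v s)) (div_nonneg (by linarith) hs.le) ?_
    have := hs.ne'
    field_simp
    ring

theorem IsRoot.isPos_of_repr_pos (hα : IsSimpleSystem W α) {v : V} (hv : IsRoot W v) {t : S}
    (ht : 0 < α.repr v t) : IsPos α v := by
  refine (hv.pos_or_neg hα).resolve_right fun h => ?_
  have := h.2 t
  simp only [map_neg, Finsupp.coe_neg, Pi.neg_apply] at this
  linarith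

/-- A simple reflection permutes the positive roots other than its own. -/
theorem IsRoot.isPos_refl_simple (hα : IsSimpleSystem W α) {v : V} (hv : IsRoot W v)
    (hp : IsPos α v) {s : S} (hs : ∀ c : ℝ, v ≠ c • α s) : IsPos α (refl (α s) v) := by
  classical
  have : ∃ t, t ≠ s ∧ α.repr v t ≠ 0 := by
    by_contra! h
    refine hs (α.repr v s) (α.ext_elem fun t => ?_)
    by_cases hts : t = s
    · simp [hts]
    · simp [h t hts, Ne.symm hts]
  obtain ⟨t, hts, ht⟩ := this
  refine (hv.map (hα.refl_mem s)).isPos_of_repr_pos hα (t := t) ?_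
  rw [repr_refl_simple_of_ne hts]
  exact lt_of_le_of_ne (hp.2 t) ht.symm

/-- A positive root made negative by a simple reflection is a multiple of the simple root. -/
theorem IsRoot.eq_smul_simple (hα : IsSimpleSystem W α) {v : V} (hv : IsRoot W v)
    (hp : IsPos α v) {s : S} (hn : IsPos α (-(refl (α s) v))) : ∃ c : ℝ, 0 < c ∧ v = c • α s := by
  by_contra! h
  refine (IsRoot.isPos_refl_simple hα hv hp fun c hc => ?_).not_neg hn
  exact h c ((isPos_simple s).pos_of_eq_smul hp hc) hc

/-- Take a positive vector `u` of least height in the orbit. Since `⟪u, u⟫ > 0`, some simple root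
pairs positively with `u`; its reflection lowers the height and preserves positivity, unless `u` is
already proportional to that simple root. -/
theorem exists_wordProd_apply_simple (hfin : Finite W) (hα : IsSimpleSystem W α) {v : V}
    (hv : IsRoot W v) : ∃ (l : List S) (s : S) (c : ℝ), c ≠ 0 ∧ wordProd α l v = c • α s := by
  obtain ⟨x, hx⟩ := exists_inner_simple_eq α (fun _ => 1)
  have hx1 : ∀ s, ⟪α s, x⟫ = 1 := fun s => by rw [hx, α.constr_basis]
  wlog hp : IsPos α v generalizing v with H
  · obtain ⟨l, s, c, hc, h⟩ := H hv.neg ((hv.pos_or_neg hα).resolve_left hp)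
    exact ⟨l, s, -c, neg_ne_zero.2 hc, by rw [neg_smul, ← h, map_neg, neg_neg]⟩
  let A : Set V := {u | IsPos α u ∧ ∃ l, u = wordProd α l v}
  have hA : A.Finite := by
    refine (Set.finite_range fun g : W => (g : V ≃ₗᵢ[ℝ] V) v).subset ?_
    rintro u ⟨-, l, rfl⟩
    exact ⟨⟨_, wordProd_mem hα l⟩, rfl⟩
  obtain ⟨u, ⟨hu, l, rfl⟩, hmin⟩ :=
    Set.exists_min_image A (fun u => ⟪u, x⟫) hA ⟨v, hp, [], rfl⟩
  have hroot := hv.map (wordProd_mem hα l)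
  set u := wordProd α l v with hu_def
  have hs : ∃ s, 0 < ⟪α s, u⟫ := by
    by_contra! h
    have h0 : ⟪u, u⟫ ≤ 0 := by
      conv_lhs => arg 2; rw [← α.linearCombination_repr u]
      rw [Finsupp.linearCombination_apply, Finsupp.sum, sum_inner]
      refine Finset.sum_nonpos fun s _ => ?_
      rw [real_inner_smul_left]
      exact mul_nonpos_of_nonneg_of_nonpos (hu.2 s) (h s)
    exact hu.1 (real_inner_self_nonpos.1 h0)
  obtain ⟨s, hs⟩ := hs
  by_cases hcase : ∃ c : ℝ, u = c • α s
  · obtain ⟨c, hc⟩ := hcase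
    exact ⟨l, s, c, ((isPos_simple s).pos_of_eq_smul hu hc).ne', hc⟩
  · push Not at hcase
    have h1 := hmin (refl (α s) u)
      ⟨hroot.isPos_refl_simple hα hu hcase, s :: l, by rw [wordProd_cons]; rfl⟩
    rw [refl_apply, inner_sub_left, real_inner_smul_left, hx1, mul_one] at h1
    have : 0 < 2 * ⟪α s, u⟫ / ‖α s‖ ^ 2 := by
      have := norm_pos_iff.2 (α.ne_zero s)
      positivity
    linarith

theorem exists_wordProd_eq (hW : IsFiniteReflectionGroup W) (hα : IsSimpleSystem W α)
    {g : V ≃ₗᵢ[ℝ] V} (hg : g ∈ W) : ∃ l, wordProd α l = g := by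
  rw [← hW.generated] at hg
  induction hg using Subgroup.closure_induction with
  | mem g hg =>
    obtain ⟨hg, v, hv, rfl⟩ := hg
    obtain ⟨l, s, c, hc, h⟩ := exists_wordProd_apply_simple hW.finite hα (v := v) ⟨hv, hg⟩
    refine ⟨l.reverse ++ [s] ++ l, ?_⟩
    rw [wordProd_append, wordProd_append, wordProd_singleton, wordProd_reverse,
      ← refl_smul hc, ← h, refl_map]
    group
  | one => exact ⟨[], rfl⟩
  | mul g h _ _ ihg ihh =>
    obtain ⟨l, rfl⟩ := ihg
    obtain ⟨l', rfl⟩ := ihh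
    exact ⟨l ++ l', wordProd_append _ _⟩
  | inv g _ ih =>
    obtain ⟨l, rfl⟩ := ih
    exact ⟨l.reverse, wordProd_reverse l⟩

theorem exists_reduced (hW : IsFiniteReflectionGroup W) (hα : IsSimpleSystem W α)
    {g : V ≃ₗᵢ[ℝ] V} (hg : g ∈ W) : ∃ l, wordProd α l = g ∧ l.length = len α g := by
  obtain ⟨l, hl⟩ := exists_wordProd_eq hW hα hg
  exact Nat.sInf_mem (s := {p | ∃ l : List S, wordProd α l = g ∧ l.length = p}) ⟨_, l, hl, rfl⟩

theorem len_mul_refl_le (hW : IsFiniteReflectionGroup W) (hα : IsSimpleSystem W α)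
    {g : V ≃ₗᵢ[ℝ] V} (hg : g ∈ W) (s : S) : len α (g * refl (α s)) ≤ len α g + 1 := by
  obtain ⟨l, rfl, hl⟩ := exists_reduced hW hα hg
  rw [← hl, ← wordProd_singleton, ← wordProd_append]
  simpa using len_wordProd_le (α := α) (l ++ [s])

/-- The exchange property. -/
theorem exists_shorter_word (hα : IsSimpleSystem W α) (l : List S) {s : S}
    (h : IsPos α (-(wordProd α l (α s)))) :
    ∃ l' : List S, l'.length + 1 = l.length ∧ wordProd α l' = wordProd α l * refl (α s) := by
  induction l with
  | nil => exact absurd h (isPos_simple s).not_neg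
  | cons t l ih =>
    have hroot := (isRoot_simple hα s).map (wordProd_mem hα l)
    rcases hroot.pos_or_neg hα with hp | hn
    -- The tail keeps `α s` positive, so `t` makes it negative: the tail sends `α s` to a multiple
    -- of `α t`, and conjugating `refl (α s)` through the tail cancels `t`.
    · rw [wordProd_cons, mul_apply] at h
      obtain ⟨c, hc, hv⟩ := hroot.eq_smul_simple hα hp h
      refine ⟨l, rfl, ?_⟩
      have h1 : refl (α t) = wordProd α l * refl (α s) * (wordProd α l)⁻¹ := by
        rw [← refl_map, hv, refl_smul hc.ne']
      rw [wordProd_cons, h1]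
      simp [mul_assoc, refl_mul_self]
    · obtain ⟨l', hl, hl'⟩ := ih hn
      exact ⟨t :: l', by simp [hl], by rw [wordProd_cons, hl', wordProd_cons, mul_assoc]⟩

theorem len_mul_refl_lt (hW : IsFiniteReflectionGroup W) (hα : IsSimpleSystem W α)
    {g : V ≃ₗᵢ[ℝ] V} (hg : g ∈ W) {s : S} (h : IsPos α (-(g (α s)))) :
    len α (g * refl (α s)) < len α g := by
  obtain ⟨l, rfl, hl⟩ := exists_reduced hW hα hg
  obtain ⟨l', hl', h'⟩ := exists_shorter_word hα l h
  have := len_wordProd_le (α := α) l'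
  rw [h'] at this
  omega

theorem len_mul_refl (hW : IsFiniteReflectionGroup W) (hα : IsSimpleSystem W α)
    {g : V ≃ₗᵢ[ℝ] V} (hg : g ∈ W) {s : S} (h : IsPos α (g (α s))) :
    len α (g * refl (α s)) = len α g + 1 := by
  have h1 := len_mul_refl_lt hW hα (W.mul_mem hg (hα.refl_mem s)) (s := s)
    (by rw [mul_apply, refl_self, map_neg, neg_neg]; exact h)
  rw [mul_assoc, refl_mul_self, mul_one] at h1
  have := len_mul_refl_le hW hα hg s
  omega

theorem isPos_of_nonneg_combination {g : V ≃ₗᵢ[ℝ] V} (h : ∀ s, IsPos α (g (α s))) {v : V}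
    (hv : IsPos α v) : IsPos α (g v) := by
  have := Module.Finite.finite_basis α
  have := Fintype.ofFinite S
  refine ⟨by simpa using hv.1, fun t => ?_⟩
  rw [← α.sum_repr v]
  simp only [map_sum, map_smul, Finsupp.coe_finsetSum, Finset.sum_apply, Finsupp.coe_smul,
    Pi.smul_apply, smul_eq_mul]
  exact Finset.sum_nonneg fun s _ => mul_nonneg (hv.2 s) ((h s).2 t)

theorem IsLongest.isPos_neg_apply (hW : IsFiniteReflectionGroup W) (hα : IsSimpleSystem W α)
    {w₀ : V ≃ₗᵢ[ℝ] V} (hw₀ : IsLongest α W w₀) {v : V} (hv : IsPos α v) :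
    IsPos α (-(w₀ v)) := by
  -- The isometry used is `-w₀`, which need not belong to `W`; only its values on simple roots
  -- matter.
  have := isPos_of_nonneg_combination (α := α) (g := w₀.trans (LinearIsometryEquiv.neg ℝ))
    (fun s => ?_) hv
  · simpa using this
  · have hr := (isRoot_simple hα s).map hw₀.1
    rcases hr.pos_or_neg hα with h | h
    · have h1 := len_mul_refl hW hα hw₀.1 h
      have h2 := hw₀.2 _ (W.mul_mem hw₀.1 (hα.refl_mem s))
      omega
    · simpa using h

theorem IsLongest.isPos_neg_inv_apply (hW : IsFiniteReflectionGroup W)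
    (hα : IsSimpleSystem W α) {w₀ : V ≃ₗᵢ[ℝ] V} (hw₀ : IsLongest α W w₀) {v : V}
    (hr : IsRoot W v) (hv : IsPos α v) : IsPos α (-(w₀⁻¹ v)) := by
  refine ((hr.map (W.inv_mem hw₀.1)).pos_or_neg hα).resolve_left fun h => ?_
  have := hw₀.isPos_neg_apply hW hα h
  rw [apply_inv_self] at this
  exact hv.not_neg this

end Roots

/-! ### Prefix products, facets and the Demazure product -/

section Subwords

variable {S : Type*} {α : Module.Basis S ℝ V} {m : ℕ} {Q : Fin m → S}

theorem sortedLT_filter_finRange (p : Fin m → Bool) : ((List.finRange m).filter p).SortedLT :=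
  ((List.pairwise_lt_finRange m).filter p).sortedLT

theorem subwordProd_empty : subwordProd α Q ∅ = 1 := by simp [subwordProd, wordProd]

theorem subwordProd_insert {J : Finset (Fin m)} {k : Fin m} (h : ∀ j ∈ J, j < k) :
    subwordProd α Q (insert k J) = subwordProd α Q J * refl (α (Q k)) := by
  have : (List.finRange m).filter (· ∈ insert k J) = (List.finRange m).filter (· ∈ J) ++ [k] := by
    refine (sortedLT_filter_finRange _).eq_of_mem_iff ?_ fun a => by simp [or_comm]
    rw [List.sortedLT_iff_pairwise, List.pairwise_append]
    refine ⟨(sortedLT_filter_finRange _).pairwise, by simp, fun a ha b hb => ?_⟩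
    simp only [List.mem_filter, List.mem_finRange, true_and, decide_eq_true_eq] at ha
    rw [List.mem_singleton.1 hb]
    exact h a ha
  rw [subwordProd, this, List.map_append, wordProd_append, List.map_singleton, wordProd_singleton]
  rfl

/-- The positions before `n` which are not in `I`. -/
def kept (I : Finset (Fin m)) (n : ℕ) : Finset (Fin m) := {k | k.val < n ∧ k ∉ I}

theorem mem_kept {I : Finset (Fin m)} {n : ℕ} {k : Fin m} :
    k ∈ kept I n ↔ k.val < n ∧ k ∉ I := by simp [kept]

/-- The product of the letters at the first `n` positions which are not in `I`. -/
noncomputable def cut (α : Module.Basis S ℝ V) (Q : Fin m → S) (I : Finset (Fin m)) (n : ℕ) :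
    V ≃ₗᵢ[ℝ] V :=
  subwordProd α Q (kept I n)

theorem cut_zero (I : Finset (Fin m)) : cut α Q I 0 = 1 := by
  simp [cut, kept, subwordProd_empty]

theorem cut_length (I : Finset (Fin m)) : cut α Q I m = subwordProd α Q Iᶜ := by
  rw [cut]
  congr 1
  ext k
  simp [mem_kept]

theorem prefixProd_eq_cut (I : Finset (Fin m)) (k : Fin m) :
    prefixProd α Q I k = cut α Q I k := by
  rw [prefixProd, cut]
  congr 1
  ext j
  simp [mem_kept]

theorem cut_succ_of_mem {I : Finset (Fin m)} {k : Fin m} (h : k ∈ I) :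
    cut α Q I (k + 1) = cut α Q I k := by
  rw [cut, cut]
  congr 1
  ext j
  simp only [mem_kept, and_congr_left_iff]
  intro hj
  have : j.val ≠ k.val := fun h' => hj (Fin.ext h' ▸ h)
  omega

theorem kept_succ_of_notMem {I : Finset (Fin m)} {k : Fin m} (h : k ∉ I) :
    kept I (k + 1) = insert k (kept I k) := by
  ext j
  simp only [mem_kept, Finset.mem_insert]
  constructor
  · rintro ⟨h1, h2⟩
    rcases Nat.lt_succ_iff_lt_or_eq.1 h1 with h1 | h1
    · exact Or.inr ⟨h1, h2⟩
    · exact Or.inl (Fin.ext h1)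
  · rintro (rfl | ⟨h1, h2⟩)
    · exact ⟨Nat.lt_succ_self _, h⟩
    · exact ⟨by omega, h2⟩

theorem cut_succ_of_notMem {I : Finset (Fin m)} {k : Fin m} (h : k ∉ I) :
    cut α Q I (k + 1) = cut α Q I k * refl (α (Q k)) := by
  rw [cut, cut, kept_succ_of_notMem h, subwordProd_insert]
  intro j hj
  exact (mem_kept.1 hj).1

theorem root_eq (I : Finset (Fin m)) (k : Fin m) :
    root α Q I k = cut α Q I k (α (Q k)) := by rw [root, prefixProd_eq_cut]

theorem refl_root (I : Finset (Fin m)) (k : Fin m) :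
    refl (root α Q I k) = cut α Q I k * refl (α (Q k)) * (cut α Q I k)⁻¹ := by
  rw [root_eq, refl_map]

theorem cut_succ_of_notMem' {I : Finset (Fin m)} {k : Fin m} (h : k ∉ I) :
    cut α Q I (k + 1) = refl (root α Q I k) * cut α Q I k := by
  rw [cut_succ_of_notMem h, refl_root]
  group

/-- All reduced expressions of `ρ` use the same number of positions, so the complement of a maximal
face is exactly one of them. -/
theorem isFacet_iff {ρ : V ≃ₗᵢ[ℝ] V} {I : Finset (Fin m)} :
    IsFacet α Q ρ I ↔ subwordProd α Q Iᶜ = ρ ∧ Iᶜ.card = len α ρ := by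
  constructor
  · rintro ⟨⟨J, hJ, h1, h2⟩, hmax⟩
    have h3 : Jᶜ ⊆ I := hmax ⟨J, by rw [compl_compl], h1, h2⟩ (by
      intro i hi
      rw [Finset.mem_compl]
      exact fun h => Finset.mem_compl.1 (hJ h) hi)
    have : J = Iᶜ := by
      refine le_antisymm hJ ?_
      intro i hi
      by_contra h
      exact Finset.mem_compl.1 hi (h3 (Finset.mem_compl.2 h))
    subst this
    exact ⟨h1, h2⟩
  · rintro ⟨h1, h2⟩
    refine ⟨⟨Iᶜ, le_rfl, h1, h2⟩, ?_⟩
    rintro I' ⟨J, hJ, h3, h4⟩ hle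
    have h5 : I'ᶜ ⊆ Iᶜ := Finset.compl_subset_compl.2 hle
    have h6 : J = Iᶜ := Finset.eq_of_subset_of_card_le (hJ.trans h5) (by omega)
    rw [h6] at hJ
    exact Finset.compl_subset_compl.1 hJ

theorem subwordProd_of_sublist {l : List (Fin m)} (h : l.Sublist (List.finRange m)) :
    subwordProd α Q l.toFinset = wordProd α (l.map Q) ∧ l.toFinset.card = l.length := by
  have hs : l.SortedLT := ((List.pairwise_lt_finRange m).sublist h).sortedLT
  refine ⟨?_, List.toFinset_card_of_nodup ((List.nodup_finRange m).sublist h)⟩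
  rw [subwordProd]
  congr 2
  exact (sortedLT_filter_finRange _).eq_of_mem_iff hs fun a => by simp

/-- The letters that the Demazure product does not discard each increase the length by one, so they
form a reduced expression. -/
theorem exists_sublist_demazure (l : List S) :
    ∃ l' : List S, l'.Sublist l ∧ wordProd α l' = demazure α l ∧
      l'.length = len α (demazure α l) := by
  induction l using List.reverseRecOn with
  | nil =>
    refine ⟨[], List.Sublist.refl _, rfl, ?_⟩
    have := len_wordProd_le (α := α) []
    simpa [demazure, wordProd_nil, eq_comm] using this
  | append_singleton l s ih =>
    obtain ⟨l', h1, h2, h3⟩ := ih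
    have hd : demazure α (l ++ [s]) =
        if len α (demazure α l * refl (α s)) = len α (demazure α l) + 1
        then demazure α l * refl (α s) else demazure α l := by
      rw [demazure, List.foldl_append]; rfl
    rw [hd]
    split_ifs with h
    · exact ⟨l' ++ [s], h1.append_right _, by rw [wordProd_append, h2, wordProd_singleton],
        by simp [h, h3]⟩
    · exact ⟨l', h1.trans (List.sublist_append_left _ _), h2, h3⟩

theorem exists_isFacet_demazure :
    ∃ I, IsFacet α Q (demazure α (List.ofFn Q)) I := by
  obtain ⟨l', h1, h2, h3⟩ := exists_sublist_demazure (α := α) (List.ofFn Q)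
  nth_rw 1 [List.ofFn_eq_map] at h1
  obtain ⟨l, hl, rfl⟩ := List.sublist_map_iff.1 h1
  obtain ⟨h4, h5⟩ := subwordProd_of_sublist (α := α) (Q := Q) hl
  refine ⟨l.toFinsetᶜ, isFacet_iff.2 ?_⟩
  rw [compl_compl, h4, h5]
  exact ⟨h2, by simpa using h3⟩

theorem inv_cut_root (I : Finset (Fin m)) (k : Fin m) :
    (cut α Q I k)⁻¹ (root α Q I k) = α (Q k) := by rw [root_eq, inv_apply_self]

theorem inv_cut_succ_root {I : Finset (Fin m)} {k : Fin m} (hk : k ∉ I) :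
    (cut α Q I (k + 1))⁻¹ (root α Q I k) = - α (Q k) := by
  rw [cut_succ_of_notMem hk, mul_inv_rev, mul_apply, inv_cut_root, refl_inv, refl_self]

end Subwords

/-! ### Roots outside a facet -/

section RootFunction

variable {W : Subgroup (V ≃ₗᵢ[ℝ] V)} {S : Type*} {α : Module.Basis S ℝ V} {m : ℕ} {Q : Fin m → S}

theorem cut_mem (hα : IsSimpleSystem W α) (I : Finset (Fin m)) (n : ℕ) : cut α Q I n ∈ W :=
  wordProd_mem hα _

theorem isRoot_root (hα : IsSimpleSystem W α) (I : Finset (Fin m)) (k : Fin m) :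
    IsRoot W (root α Q I k) := by
  rw [root_eq]; exact (isRoot_simple hα _).map (cut_mem hα _ _)

variable [FiniteDimensional ℝ V]

/-- Length minus number of kept letters never increases with `n`, and it is zero at `0` and at `m`.
-/
theorem IsFacet.len_cut (hW : IsFiniteReflectionGroup W) (hα : IsSimpleSystem W α)
    {ρ : V ≃ₗᵢ[ℝ] V} {I : Finset (Fin m)} (hI : IsFacet α Q ρ I) {n : ℕ} (hn : n ≤ m) :
    len α (cut α Q I n) = (kept I n).card := by
  obtain ⟨h1, h2⟩ := isFacet_iff.1 hI
  have step : ∀ k : Fin m,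
      (len α (cut α Q I (k + 1)) : ℤ) - (kept I (k + 1)).card ≤
      len α (cut α Q I k) - (kept I k).card := by
    intro k
    by_cases hk : k ∈ I
    · rw [cut_succ_of_mem hk]
      have : (kept I k).card ≤
          (kept I (k + 1)).card := by
        refine Finset.card_le_card fun j hj => ?_
        rw [mem_kept] at hj ⊢
        exact ⟨by omega, hj.2⟩
      omega
    · rw [cut_succ_of_notMem hk, kept_succ_of_notMem hk, Finset.card_insert_of_notMem (by simp [mem_kept])]
      have := len_mul_refl_le hW hα (cut_mem (Q := Q) hα I k) (Q k)
      omega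
  have anti : ∀ a b : ℕ, a ≤ b → b ≤ m →
      (len α (cut α Q I b) : ℤ) - (kept I b).card ≤
      len α (cut α Q I a) - (kept I a).card := by
    intro a b hab
    induction b, hab using Nat.le_induction with
    | base => intro _; exact le_rfl
    | succ b hab ih => intro hb; exact (step ⟨b, hb⟩).trans (ih (by omega))
  have h3 := anti 0 n (Nat.zero_le _) hn
  have h4 := anti n m hn le_rfl
  have h5 : len α (cut α Q I 0) = 0 := by
    have := len_wordProd_le (α := α) []
    rw [wordProd_nil] at this
    rw [cut_zero]
    simpa using this
  have h6 : (kept I m) = Iᶜ := by ext; simp [mem_kept]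
  rw [h5] at h3
  rw [cut_length, h1, h6, h2] at h4
  have h7 : kept I 0 = ∅ := by simp [kept]
  rw [h7, Finset.card_empty] at h3
  omega

/-- Prefixes of a reduced expression are reduced, so a kept letter cannot shorten the product before
it. -/
theorem IsFacet.isPos_root (hW : IsFiniteReflectionGroup W) (hα : IsSimpleSystem W α)
    {ρ : V ≃ₗᵢ[ℝ] V} {I : Finset (Fin m)} (hI : IsFacet α Q ρ I) {k : Fin m} (hk : k ∉ I) :
    IsPos α (root α Q I k) := by
  refine ((isRoot_root hα I k).pos_or_neg hα).resolve_right fun h => ?_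
  rw [root_eq] at h
  have h1 := len_mul_refl_lt hW hα (cut_mem hα I k) h
  rw [← cut_succ_of_notMem hk, hI.len_cut hW hα k.2, hI.len_cut hW hα k.2.le] at h1
  rw [Nat.succ_eq_add_one, kept_succ_of_notMem hk,
    Finset.card_insert_of_notMem (by simp [mem_kept])] at h1
  omega

/-- When a root changes sign, it is a multiple of the value of the root function. -/
theorem exists_root_eq_smul (hα : IsSimpleSystem W α) {I : Finset (Fin m)} {k : Fin m} {v : V}
    (hv : IsRoot W v) (h1 : IsPos α ((cut α Q I k)⁻¹ v))
    (h2 : IsPos α (-((cut α Q I (k + 1))⁻¹ v))) :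
    k ∉ I ∧ ∃ c : ℝ, 0 < c ∧ v = c • root α Q I k := by
  have hk : k ∉ I := fun hk => by
    rw [cut_succ_of_mem hk] at h2
    exact h1.not_neg h2
  rw [cut_succ_of_notMem hk, mul_inv_rev, refl_inv, mul_apply] at h2
  obtain ⟨c, hc, h⟩ := (hv.map (W.inv_mem (cut_mem hα I k))).eq_smul_simple hα h1 h2
  refine ⟨hk, c, hc, ?_⟩
  rw [root_eq, ← map_smul, ← h, apply_inv_self]

/-- A positive root which has become negative stays negative. -/
theorem IsFacet.isPos_neg_cut_inv_mono (hW : IsFiniteReflectionGroup W)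
    (hα : IsSimpleSystem W α) {ρ : V ≃ₗᵢ[ℝ] V} {I : Finset (Fin m)} (hI : IsFacet α Q ρ I)
    {v : V} (hv : IsRoot W v) (hp : IsPos α v) {a b : ℕ} (hab : a ≤ b) (hb : b ≤ m)
    (h : IsPos α (-((cut α Q I a)⁻¹ v))) : IsPos α (-((cut α Q I b)⁻¹ v)) := by
  induction b, hab using Nat.le_induction with
  | base => exact h
  | succ b hab ih =>
    specialize ih (by omega)
    refine ((hv.map (W.inv_mem (cut_mem hα I _))).pos_or_neg hα).resolve_left fun h' => ?_
    -- A change back would make `-v` a positive multiple of a root outside `I`, and those are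
    -- positive.
    obtain ⟨hk, c, hc, h1⟩ := exists_root_eq_smul (Q := Q) (k := ⟨b, hb⟩) hα hv.neg
      (by rw [map_neg]; exact ih) (by rw [map_neg, neg_neg]; exact h')
    have := (hI.isPos_root hW hα hk).smul hc
    rw [← h1] at this
    exact hp.not_neg this

/-- The roots at the positions outside of a facet are pairwise not proportional. -/
theorem IsFacet.eq_of_refl_root_eq (hW : IsFiniteReflectionGroup W) (hα : IsSimpleSystem W α)
    {ρ : V ≃ₗᵢ[ℝ] V} {I : Finset (Fin m)} (hI : IsFacet α Q ρ I) {j k : Fin m} (hj : j ∉ I)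
    (hk : k ∉ I) (h : refl (root α Q I j) = refl (root α Q I k)) : j = k := by
  wlog hlt : j < k generalizing j k with H
  · rcases lt_trichotomy j k with h' | h' | h'
    · exact H hj hk h h'
    · exact h'
    · exact (H hk hj h.symm h').symm
  exfalso
  have hpj := hI.isPos_root hW hα hj
  have hpk := hI.isPos_root hW hα hk
  obtain ⟨c, -, hc⟩ := exists_smul_of_refl_eq hpk.1 h
  have hc0 := hpj.pos_of_eq_smul hpk hc
  -- The root at `j` turns negative just after `j` and is still negative at `k`, where the root at
  -- `k` pulls back to a simple root.
  have h1 : IsPos α (-((cut α Q I k)⁻¹ (root α Q I j))) :=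
    hI.isPos_neg_cut_inv_mono hW hα (isRoot_root hα I j) hpj (Nat.succ_le_of_lt hlt) k.2.le
      (by rw [Nat.succ_eq_add_one, inv_cut_succ_root hj, neg_neg]; exact isPos_simple _)
  have h2 := h1.smul hc0
  rw [smul_neg, ← map_smul, ← hc, inv_cut_root] at h2
  exact (isPos_simple _).not_neg h2

/-- Up to proportionality, all roots occur at positions outside of a facet. -/
theorem IsFacet.exists_refl_root_eq (hW : IsFiniteReflectionGroup W) (hα : IsSimpleSystem W α)
    {w₀ : V ≃ₗᵢ[ℝ] V} (hw₀ : IsLongest α W w₀) {I : Finset (Fin m)} (hI : IsFacet α Q w₀ I)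
    {v : V} (hv : IsRoot W v) : ∃ j ∉ I, refl v = refl (root α Q I j) := by
  wlog hp : IsPos α v generalizing v with H
  · obtain ⟨j, hj, h⟩ := H hv.neg ((hv.pos_or_neg hα).resolve_left hp)
    exact ⟨j, hj, by rwa [refl_neg] at h⟩
  by_contra! hcon
  -- A positive root proportional to no root outside `I` would never change sign along the word, yet
  -- `w₀⁻¹` makes it negative.
  have key : ∀ n ≤ m, IsPos α ((cut α Q I n)⁻¹ v) := by
    intro n
    induction n with
    | zero => intro _; simpa [cut_zero] using hp
    | succ n ih =>
      intro hn
      refine ((hv.map (W.inv_mem (cut_mem hα I _))).pos_or_neg hα).resolve_right fun h => ?_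
      obtain ⟨hk, c, hc, h1⟩ :=
        exists_root_eq_smul (Q := Q) (k := ⟨n, hn⟩) hα hv (ih (by omega)) h
      exact hcon _ hk (by rw [h1, refl_smul hc.ne'])
  have h1 := key m le_rfl
  rw [cut_length, (isFacet_iff.1 hI).1] at h1
  exact h1.not_neg (hw₀.isPos_neg_inv_apply hW hα hv hp)

end RootFunction

/-! ### Flips and their effect on the weights -/

section Flips

variable {W : Subgroup (V ≃ₗᵢ[ℝ] V)} {S : Type*} {α : Module.Basis S ℝ V} {m : ℕ} {Q : Fin m → S}

/-- `J` is obtained from `I` by exchanging the position `i` of `I` with the position `j` outside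
of `I`, where the roots at `i` and `j` are proportional. -/
structure IsFlip (α : Module.Basis S ℝ V) (Q : Fin m → S) (I : Finset (Fin m)) (i j : Fin m)
    (J : Finset (Fin m)) : Prop where
  mem : i ∈ I
  notMem : j ∉ I
  eq : J = insert j (I.erase i)
  refl_eq : refl (root α Q I i) = refl (root α Q I j)

variable {I J : Finset (Fin m)} {i j : Fin m}

theorem IsFlip.ne (h : IsFlip α Q I i j J) : i ≠ j := fun e => h.notMem (e ▸ h.mem)

theorem IsFlip.mem' (h : IsFlip α Q I i j J) : j ∈ J := by simp [h.eq]

theorem IsFlip.notMem' (h : IsFlip α Q I i j J) : i ∉ J := by simp [h.eq, h.ne]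

theorem IsFlip.mem_iff (h : IsFlip α Q I i j J) {k : Fin m} (hi : k ≠ i) (hj : k ≠ j) :
    k ∈ J ↔ k ∈ I := by simp [h.eq, hi, hj]

/-- Changing the status of `i` and of `j` each multiplies the later prefixes on the left by the same
reflection, so past both positions the changes cancel. -/
theorem IsFlip.cut_eq (h : IsFlip α Q I i j J) {n : ℕ} (hn : n ≤ m) :
    cut α Q J n = if (i.val < n ↔ j.val < n) then cut α Q I n
      else refl (root α Q I i) * cut α Q I n := by
  induction n with
  | zero => simp [cut_zero]
  | succ n ih =>
    specialize ih (by omega)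
    obtain ⟨k, rfl⟩ : ∃ k : Fin m, k.val = n := ⟨⟨n, hn⟩, rfl⟩
    have hij : i.val ≠ j.val := fun e => h.ne (Fin.ext e)
    have hss := refl_mul_self (root α Q I i)
    by_cases hi : k = i
    · subst hi
      rw [cut_succ_of_mem h.mem, cut_succ_of_notMem h.notMem', ih]
      have h1 : cut α Q I k * refl (α (Q k)) = refl (root α Q I k) * cut α Q I k := by
        rw [refl_root]; group
      by_cases hj : j.val < k.val
      · rw [if_neg (by omega), if_pos (by omega), mul_assoc, h1, ← mul_assoc, hss, one_mul]
      · rw [if_pos (by omega), if_neg (by omega), h1]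
    by_cases hj : k = j
    · subst hj
      rw [cut_succ_of_mem h.mem', cut_succ_of_notMem' h.notMem, ih, ← h.refl_eq]
      by_cases hlt : i.val < k.val
      · rw [if_neg (by omega), if_pos (by omega)]
      · rw [if_pos (by omega), if_neg (by omega), ← mul_assoc, hss, one_mul]
    have hi' : k.val ≠ i.val := fun e => hi (Fin.ext e)
    have hj' : k.val ≠ j.val := fun e => hj (Fin.ext e)
    have hiff : (i.val < k.val + 1 ↔ j.val < k.val + 1) ↔ (i.val < k.val ↔ j.val < k.val) := by
      omega
    simp only [hiff]
    by_cases hk : k ∈ I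
    · rw [cut_succ_of_mem hk, cut_succ_of_mem ((h.mem_iff hi hj).2 hk), ih]
    · rw [cut_succ_of_notMem hk, cut_succ_of_notMem (fun hk' => hk ((h.mem_iff hi hj).1 hk')), ih]
      split_ifs
      · rfl
      · rw [mul_assoc]

theorem IsFlip.root_eq_ite (h : IsFlip α Q I i j J) (k : Fin m) :
    root α Q J k = if (i < k ↔ j < k) then root α Q I k
      else refl (root α Q I i) (root α Q I k) := by
  rw [root_eq, h.cut_eq k.2.le, root_eq I k]
  by_cases hc : (i < k ↔ j < k)
  · rw [if_pos hc, if_pos (by simpa using hc)]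
  · rw [if_neg hc, if_neg (by simpa using hc), mul_apply]

theorem IsFlip.isFacet (h : IsFlip α Q I i j J) {ρ : V ≃ₗᵢ[ℝ] V} (hI : IsFacet α Q ρ I) :
    IsFacet α Q ρ J := by
  rw [isFacet_iff] at hI ⊢
  refine ⟨?_, ?_⟩
  · rw [← cut_length, h.cut_eq le_rfl, if_pos (by simp), cut_length, hI.1]
  · rw [← hI.2, Finset.card_compl, Finset.card_compl, h.eq,
      Finset.card_insert_of_notMem (by simp [h.notMem]), Finset.card_erase_add_one h.mem]

theorem IsFlip.refl_root_of_refl_eq (h : IsFlip α Q I i j J) {k : Fin m}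
    (hk : refl (root α Q I k) = refl (root α Q I i)) :
    refl (root α Q J k) = refl (root α Q I i) := by
  rw [h.root_eq_ite]
  split_ifs
  · exact hk
  · rw [refl_map, hk]; group

theorem IsFlip.symm (h : IsFlip α Q I i j J) : IsFlip α Q J j i I where
  mem := h.mem'
  notMem := h.notMem'
  eq := by
    rw [h.eq, Finset.erase_insert (by simp [h.notMem]), Finset.insert_erase h.mem]
  refl_eq := by
    rw [h.refl_root_of_refl_eq h.refl_eq.symm, h.refl_root_of_refl_eq rfl]

variable [FiniteDimensional ℝ V]

theorem inner_weight_eq (v : V) (s : S) :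
    ⟪v, weight α s⟫ = ⟪α s, α s⟫ / 2 * α.repr v s := by
  have := FiniteDimensional.complete ℝ V
  rw [real_inner_comm, weight, real_inner_smul_left, InnerProductSpace.toDual_symm_apply]
  simp

theorem weightFun_eq (I : Finset (Fin m)) (k : Fin m) :
    weightFun α Q I k = cut α Q I k (weight α (Q k)) := by rw [weightFun, prefixProd_eq_cut]

theorem inner_weightFun (v : V) (I : Finset (Fin m)) (k : Fin m) :
    ⟪v, weightFun α Q I k⟫ =
      ⟪α (Q k), α (Q k)⟫ / 2 * α.repr ((cut α Q I k)⁻¹ v) (Q k) := by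
  rw [← inner_weight_eq, weightFun_eq, ← (cut α Q I k).inner_map_map ((cut α Q I k)⁻¹ v),
    apply_inv_self]

theorem inner_weightFun_nonneg {v : V} {I : Finset (Fin m)} {k : Fin m}
    (h : IsPos α ((cut α Q I k)⁻¹ v)) : 0 ≤ ⟪v, weightFun α Q I k⟫ := by
  rw [inner_weightFun]
  exact mul_nonneg (div_nonneg real_inner_self_nonneg zero_le_two) (h.2 _)

theorem inner_root_weightFun_pos (I : Finset (Fin m)) (k : Fin m) :
    0 < ⟪root α Q I k, weightFun α Q I k⟫ := by
  rw [inner_weightFun, inv_cut_root, α.repr_self, Finsupp.single_eq_same, mul_one]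
  have := real_inner_self_pos.2 (α.ne_zero (Q k))
  linarith

theorem IsFlip.weightFun_eq_ite (h : IsFlip α Q I i j J) (k : Fin m) :
    weightFun α Q J k = if (i < k ↔ j < k) then weightFun α Q I k
      else refl (root α Q I i) (weightFun α Q I k) := by
  rw [weightFun_eq, h.cut_eq k.2.le, weightFun_eq I k]
  by_cases hc : (i < k ↔ j < k)
  · rw [if_pos hc, if_pos (by simpa using hc)]
  · rw [if_neg hc, if_neg (by simpa using hc), mul_apply]

/-- A flip is increasing when the root is positive. -/
theorem IsFlip.isPos_root (hW : IsFiniteReflectionGroup W) (hα : IsSimpleSystem W α)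
    {ρ : V ≃ₗᵢ[ℝ] V} (hI : IsFacet α Q ρ I) (h : IsFlip α Q I i j J) (hij : i < j) :
    IsPos α (root α Q I i) := by
  have h1 := (h.isFacet hI).isPos_root hW hα h.notMem'
  rwa [h.root_eq_ite, if_pos (by simp [hij.le])] at h1

theorem IsFlip.isPos_neg_root (hW : IsFiniteReflectionGroup W) (hα : IsSimpleSystem W α)
    {ρ : V ≃ₗᵢ[ℝ] V} (hI : IsFacet α Q ρ I) (h : IsFlip α Q I i j J) (hij : j < i) :
    IsPos α (-(root α Q I i)) := by
  have h1 := (h.isFacet hI).isPos_root hW hα h.notMem'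
  rwa [h.root_eq_ite, if_neg (by simp [hij]), refl_self] at h1

theorem IsFlip.root_eq_smul (hW : IsFiniteReflectionGroup W) (hα : IsSimpleSystem W α)
    {ρ : V ≃ₗᵢ[ℝ] V} (hI : IsFacet α Q ρ I) (h : IsFlip α Q I i j J) :
    ∃ c : ℝ, 0 < c ∧ root α Q J j = -(c • root α Q I i) := by
  have hpj := hI.isPos_root hW hα h.notMem
  obtain ⟨c, -, hc⟩ := exists_smul_of_refl_eq hpj.1 h.refl_eq
  rcases lt_or_gt_of_ne h.ne with hlt | hlt
  · refine ⟨c, (h.isPos_root hW hα hI hlt).pos_of_eq_smul hpj hc, ?_⟩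
    rw [h.root_eq_ite, if_neg (by simp [hlt]), hc, map_smul, refl_self, smul_neg]
  · refine ⟨-c, (h.isPos_neg_root hW hα hI hlt).pos_of_eq_smul hpj (by simpa using hc), ?_⟩
    rw [h.root_eq_ite, if_pos (by simp [hlt.le]), hc]
    simp

/-- The pairing of a root with `w(I,k)` is a nonnegative multiple of a coordinate of the root pulled
back to `k`. The root at `j` pulls back to a positive one up to `j` and to a negative one
afterwards. If `j < i`, the root at `i` is a negative multiple of it, and the two signs compensate.
-/
theorem IsFlip.inner_root_weightFun_nonneg (hW : IsFiniteReflectionGroup W)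
    (hα : IsSimpleSystem W α) {ρ : V ≃ₗᵢ[ℝ] V} (hI : IsFacet α Q ρ I) (h : IsFlip α Q I i j J)
    {k : Fin m} (hk : ¬(i < k ↔ j < k)) : 0 ≤ ⟪root α Q I i, weightFun α Q I k⟫ := by
  have hpj := hI.isPos_root hW hα h.notMem
  obtain ⟨c, -, hc⟩ := exists_smul_of_refl_eq (isRoot_root hα I i).1 h.refl_eq.symm
  have hr := isRoot_root (Q := Q) hα I j
  rw [hc, real_inner_smul_left]
  rcases lt_or_gt_of_ne h.ne with hlt | hlt
  · have hc0 := hpj.pos_of_eq_smul (h.isPos_root hW hα hI hlt) hc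
    refine mul_nonneg hc0.le (inner_weightFun_nonneg ?_)
    refine ((hr.map (W.inv_mem (cut_mem hα I k))).pos_or_neg hα).resolve_right fun hn => ?_
    have := hI.isPos_neg_cut_inv_mono hW hα hr hpj (b := j.val) (by omega) j.2.le hn
    rw [inv_cut_root] at this
    exact (isPos_simple _).not_neg this
  · have hc0 := hpj.pos_of_eq_smul (h.isPos_neg_root hW hα hI hlt)
      (c := -c) (by rw [hc, neg_smul])
    rw [← neg_mul_neg, ← inner_neg_left]
    refine mul_nonneg hc0.le (inner_weightFun_nonneg ?_)
    rw [map_neg]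
    refine hI.isPos_neg_cut_inv_mono hW hα hr hpj (a := j.val + 1) (by omega) k.2.le ?_
    rw [inv_cut_succ_root h.notMem, neg_neg]
    exact isPos_simple _

/-- A flip moves all weights in the direction opposite to the root. -/
theorem IsFlip.exists_weightFun_eq (hW : IsFiniteReflectionGroup W)
    (hα : IsSimpleSystem W α) {ρ : V ≃ₗᵢ[ℝ] V} (hI : IsFacet α Q ρ I) (h : IsFlip α Q I i j J) :
    ∃ d : Fin m → ℝ, (∀ k, 0 ≤ d k) ∧ (∃ k, 0 < d k) ∧
      ∀ k, weightFun α Q J k = weightFun α Q I k - d k • root α Q I i := by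
  have hroot := (isRoot_root (Q := Q) hα I i).1
  refine ⟨fun k => if (i < k ↔ j < k) then 0
    else 2 * ⟪root α Q I i, weightFun α Q I k⟫ / ‖root α Q I i‖ ^ 2, fun k => ?_, ?_, fun k => ?_⟩
  · dsimp only
    split_ifs with hk
    · exact le_rfl
    · have := h.inner_root_weightFun_nonneg hW hα hI hk
      positivity
  · have hn := norm_pos_iff.2 hroot
    -- The strict shift is found at the later of `i` and `j`, whose root, proportional to the
    -- flipped one, pairs nontrivially with the weight at the same position.
    rcases lt_or_gt_of_ne h.ne with hlt | hlt
    · refine ⟨j, ?_⟩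
      have hk : ¬(i < j ↔ j < j) := by simp [hlt]
      simp only [if_neg hk]
      obtain ⟨c, hc0, hc⟩ := exists_smul_of_refl_eq (isRoot_root hα I i).1 h.refl_eq.symm
      have h1 := inner_root_weightFun_pos (α := α) (Q := Q) I j
      have h2 := h.inner_root_weightFun_nonneg hW hα hI hk
      have h3 : ⟪root α Q I i, weightFun α Q I j⟫ ≠ 0 := by
        rw [hc, real_inner_smul_left]
        exact mul_ne_zero hc0 h1.ne'
      have := lt_of_le_of_ne h2 h3.symm
      positivity
    · refine ⟨i, ?_⟩
      have hk : ¬(i < i ↔ j < i) := by simp [hlt]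
      simp only [if_neg hk]
      have := inner_root_weightFun_pos (α := α) (Q := Q) I i
      positivity
  · rw [h.weightFun_eq_ite]
    by_cases hk : (i < k ↔ j < k)
    · simp only [if_pos hk, zero_smul, sub_zero]
    · simp only [if_neg hk, refl_apply]

theorem IsFacet.exists_isFlip (hW : IsFiniteReflectionGroup W) (hα : IsSimpleSystem W α)
    {w₀ : V ≃ₗᵢ[ℝ] V} (hw₀ : IsLongest α W w₀) (hI : IsFacet α Q w₀ I) (hi : i ∈ I) :
    ∃ j J, IsFlip α Q I i j J := by
  obtain ⟨j, hj, h⟩ := hI.exists_refl_root_eq hW hα hw₀ (isRoot_root hα I i)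
  exact ⟨j, _, hi, hj, rfl, h⟩

end Flips

/-! ### Uniqueness of the facet with roots in a given chamber's positive system -/

section RootConfigurations

variable {W : Subgroup (V ≃ₗᵢ[ℝ] V)} {S : Type*} {α : Module.Basis S ℝ V} {m : ℕ} {Q : Fin m → S}

theorem IsRealizing.eq_of_refl_root_eq (hα : IsSimpleSystem W α) {ρ : V ≃ₗᵢ[ℝ] V}
    (hreal : IsRealizing α Q ρ) {I : Finset (Fin m)} (hI : IsFacet α Q ρ I) {i k : Fin m}
    (hi : i ∈ I) (hk : k ∈ I) (h : refl (root α Q I i) = refl (root α Q I k)) : i = k := by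
  by_contra hne
  obtain ⟨c, -, hc⟩ := exists_smul_of_refl_eq (isRoot_root hα I k).1 h
  have hli := (hreal I hI).1.comp ![⟨i, hi⟩, ⟨k, hk⟩] (by
    intro a b hab
    fin_cases a <;> fin_cases b <;> simp_all)
  have := LinearIndependent.pair_iff.1 (by
    convert hli using 1
    ext a
    fin_cases a <;> rfl : LinearIndependent ℝ ![root α Q I i, root α Q I k])
  have := (this c (-1) (by rw [hc]; simp)).2
  norm_num at this

/-- The roots of `I` are in the image under `w` of the set of positive roots. -/
def RootsIn (α : Module.Basis S ℝ V) (Q : Fin m → S) (w : V ≃ₗᵢ[ℝ] V) (I : Finset (Fin m)) :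
    Prop :=
  ∀ i ∈ I, IsPos α (w⁻¹ (root α Q I i))

variable [FiniteDimensional ℝ V]

/-- The sets `w(Φ⁺)` and `ws(Φ⁺)` differ only on the line through `w(α_s)`. -/
theorem RootsIn.isPos_of_refl_ne (hα : IsSimpleSystem W α) {w : V ≃ₗᵢ[ℝ] V} (hw : w ∈ W) {s : S}
    {I : Finset (Fin m)} (h : RootsIn α Q (w * refl (α s)) I) {k : Fin m} (hk : k ∈ I)
    (hne : refl (root α Q I k) ≠ refl (w (α s))) : IsPos α (w⁻¹ (root α Q I k)) := by
  have hr := ((isRoot_root (Q := Q) hα I k).map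
    (W.inv_mem (W.mul_mem hw (hα.refl_mem s))))
  have h1 := hr.isPos_refl_simple hα (h k hk) (s := s) fun c hc => hne ?_
  · rwa [mul_inv_rev, refl_inv, mul_apply, refl_refl] at h1
  · have hc0 : c ≠ 0 := by
      rintro rfl
      exact hr.1 (by rw [hc, zero_smul])
    rw [mul_inv_rev, refl_inv, mul_apply] at hc
    have h2 : w⁻¹ (root α Q I k) = (-c) • α s := by
      rw [← refl_refl (α s) (w⁻¹ _), hc, map_smul, refl_self, smul_neg, neg_smul]
    rw [← apply_inv_self w (root α Q I k), h2, map_smul, refl_smul (neg_ne_zero.2 hc0)]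

/-- Each surviving root is either unchanged, hence off the line of `w(α_s)` by independence, or
reflected by `refl (w (α s))`, which maps `ws(Φ⁺)` onto `w(Φ⁺)`. The root at `j` is a negative
multiple of the one at `i`. Its sign, kept in the conclusion, shows that `J` does not already
satisfy the condition for `ws`. -/
theorem RootsIn.flip (hW : IsFiniteReflectionGroup W) (hα : IsSimpleSystem W α)
    {ρ : V ≃ₗᵢ[ℝ] V} (hreal : IsRealizing α Q ρ) {w : V ≃ₗᵢ[ℝ] V} (hw : w ∈ W) {s : S}
    {I J : Finset (Fin m)} (hI : IsFacet α Q ρ I) (h : RootsIn α Q (w * refl (α s)) I)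
    {i j : Fin m} (hr : refl (root α Q I i) = refl (w (α s))) (hflip : IsFlip α Q I i j J) :
    RootsIn α Q w J ∧ IsPos α (-((w * refl (α s))⁻¹ (root α Q J j))) := by
  obtain ⟨c, -, hc⟩ := exists_smul_of_refl_eq (isRoot_root hα I i).1 hr.symm
  have hp := h i hflip.mem
  obtain ⟨c', hc', hj⟩ := hflip.root_eq_smul hW hα hI
  have hneg : IsPos α (-((w * refl (α s))⁻¹ (root α Q J j))) := by
    rw [hj, map_neg, neg_neg, map_smul]
    exact hp.smul hc'
  refine ⟨fun k hk => ?_, hneg⟩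
  by_cases hkj : k = j
  · subst hkj
    rw [mul_inv_rev, refl_inv, mul_apply] at hneg
    have hwj : w⁻¹ (root α Q J k) = (-(c' * c)) • α s := by
      rw [hj, hc, smul_smul, map_neg, map_smul, inv_apply_self, neg_smul]
    rw [hwj, map_smul, refl_self, smul_neg, neg_neg] at hneg
    rwa [hwj]
  · have hki : k ≠ i := fun e => hflip.notMem' (e ▸ hk)
    have hkI := (hflip.mem_iff hki hkj).1 hk
    rw [hflip.root_eq_ite]
    split_ifs
    · refine h.isPos_of_refl_ne hα hw hkI fun e => hki ?_
      exact hreal.eq_of_refl_root_eq hα hI hkI hflip.mem (e.trans hr.symm)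
    · have h1 := h k hkI
      rw [hr, refl_map, mul_apply, mul_apply, inv_apply_self]
      rwa [mul_inv_rev, refl_inv, mul_apply] at h1

/-- Roots in `w₀(Φ⁺)` are negative, while those outside a facet are positive. So a letter is skipped
exactly when it would shorten the current prefix, and this greedy rule determines the facet. -/
theorem RootsIn.eq_of_longest (hW : IsFiniteReflectionGroup W) (hα : IsSimpleSystem W α)
    {w₀ : V ≃ₗᵢ[ℝ] V} (hw₀ : IsLongest α W w₀) {I J : Finset (Fin m)}
    (hI : IsFacet α Q w₀ I) (hJ : IsFacet α Q w₀ J) (h : RootsIn α Q w₀ I)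
    (h' : RootsIn α Q w₀ J) : I = J := by
  have key : ∀ {I}, IsFacet α Q w₀ I → RootsIn α Q w₀ I → ∀ k,
      (k ∈ I ↔ ¬ IsPos α (cut α Q I k (α (Q k)))) := by
    intro I hI h k
    rw [← root_eq]
    refine ⟨fun hk hp => ?_, fun hk => ?_⟩
    · exact (h k hk).not_neg (hw₀.isPos_neg_inv_apply hW hα (isRoot_root hα I k) hp)
    · by_contra hk'
      exact hk (hI.isPos_root hW hα hk')
  have hcut : ∀ n ≤ m, cut α Q I n = cut α Q J n := by
    intro n
    induction n with
    | zero => intro _; rw [cut_zero, cut_zero]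
    | succ n ih =>
      intro hn
      specialize ih (by omega)
      obtain ⟨k, rfl⟩ : ∃ k : Fin m, k.val = n := ⟨⟨n, hn⟩, rfl⟩
      have hiff : k ∈ I ↔ k ∈ J := by rw [key hI h, key hJ h', ih]
      by_cases hk : k ∈ I
      · rw [cut_succ_of_mem hk, cut_succ_of_mem (hiff.1 hk), ih]
      · rw [cut_succ_of_notMem hk, cut_succ_of_notMem (fun e => hk (hiff.2 e)), ih]
  ext k
  rw [key hI h, key hJ h', hcut k k.2.le]

/-- Facets with a root along `w(α_s)` are flipped and the others kept, so that uniqueness for `w`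
applies. Two flips with the same result agree because a flip is undone by flipping back. A flipped
and an unflipped facet cannot coincide, by the sign of the root at the new position. -/
theorem RootsIn.eq_of_mul_refl (hW : IsFiniteReflectionGroup W) (hα : IsSimpleSystem W α)
    {w₀ : V ≃ₗᵢ[ℝ] V} (hw₀ : IsLongest α W w₀) (hreal : IsRealizing α Q w₀)
    {w : V ≃ₗᵢ[ℝ] V} (hw : w ∈ W) (s : S)
    (huniq : ∀ I J, IsFacet α Q w₀ I → IsFacet α Q w₀ J → RootsIn α Q w I → RootsIn α Q w J →
      I = J)
    {I J : Finset (Fin m)} (hI : IsFacet α Q w₀ I) (hJ : IsFacet α Q w₀ J)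
    (h : RootsIn α Q (w * refl (α s)) I) (h' : RootsIn α Q (w * refl (α s)) J) : I = J := by
  by_cases hi : ∃ i ∈ I, refl (root α Q I i) = refl (w (α s))
  · obtain ⟨i, hi, hr⟩ := hi
    obtain ⟨j, I', hf⟩ := hI.exists_isFlip hW hα hw₀ hi
    obtain ⟨h1, h2⟩ := h.flip hW hα hreal hw hI hr hf
    have hI' := hf.isFacet hI
    by_cases hi' : ∃ i' ∈ J, refl (root α Q J i') = refl (w (α s))
    · obtain ⟨i', hi', hr'⟩ := hi'
      obtain ⟨j', J', hf'⟩ := hJ.exists_isFlip hW hα hw₀ hi'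
      obtain ⟨h1', h2'⟩ := h'.flip hW hα hreal hw hJ hr' hf'
      obtain rfl := huniq I' J' hI' (hf'.isFacet hJ) h1 h1'
      have e1 := (hf.refl_root_of_refl_eq rfl).trans hr
      have e2 := (hf'.refl_root_of_refl_eq rfl).trans hr'
      have e3 := (hf.refl_root_of_refl_eq hf.refl_eq.symm).trans hr
      have e4 := (hf'.refl_root_of_refl_eq hf'.refl_eq.symm).trans hr'
      obtain rfl := hI'.eq_of_refl_root_eq hW hα hf.notMem' hf'.notMem' (e1.trans e2.symm)
      obtain rfl := hreal.eq_of_refl_root_eq hα hI' hf.mem' hf'.mem' (e3.trans e4.symm)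
      rw [hf.symm.eq, hf'.symm.eq]
    · push Not at hi'
      obtain rfl := huniq I' J hI' hJ h1 fun k hk =>
        h'.isPos_of_refl_ne hα hw hk (hi' k hk)
      exact absurd h2 (h' j hf.mem').not_neg
  · push Not at hi
    have h1 : RootsIn α Q w I := fun k hk => h.isPos_of_refl_ne hα hw hk (hi k hk)
    by_cases hi' : ∃ i' ∈ J, refl (root α Q J i') = refl (w (α s))
    · obtain ⟨i', hi', hr'⟩ := hi'
      obtain ⟨j', J', hf'⟩ := hJ.exists_isFlip hW hα hw₀ hi'
      obtain ⟨h1', h2'⟩ := h'.flip hW hα hreal hw hJ hr' hf'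
      obtain rfl := huniq I J' hI (hf'.isFacet hJ) h1 h1'
      exact absurd h2' (h j' hf'.mem').not_neg
    · push Not at hi'
      exact huniq I J hI hJ h1 fun k hk => h'.isPos_of_refl_ne hα hw hk (hi' k hk)

/-- At most one facet has its roots in `w` applied to the positive roots. -/
theorem RootsIn.unique (hW : IsFiniteReflectionGroup W) (hα : IsSimpleSystem W α)
    {w₀ : V ≃ₗᵢ[ℝ] V} (hw₀ : IsLongest α W w₀) (hreal : IsRealizing α Q w₀)
    {w : V ≃ₗᵢ[ℝ] V} (hw : w ∈ W) {I J : Finset (Fin m)}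
    (hI : IsFacet α Q w₀ I) (hJ : IsFacet α Q w₀ J) (h : RootsIn α Q w I)
    (h' : RootsIn α Q w J) : I = J := by
  -- Induction along a gallery of chambers starting at that of `w₀`.
  obtain ⟨l, hl⟩ := exists_wordProd_eq hW hα (W.mul_mem (W.inv_mem hw₀.1) hw)
  obtain rfl : w = w₀ * wordProd α l := by rw [hl]; group
  clear hl hw
  induction l using List.reverseRecOn generalizing I J with
  | nil =>
    rw [wordProd_nil, mul_one] at h h'
    exact RootsIn.eq_of_longest hW hα hw₀ hI hJ h h'
  | append_singleton l s ih =>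
    rw [wordProd_append, wordProd_singleton, ← mul_assoc] at h h'
    exact RootsIn.eq_of_mul_refl hW hα hw₀ hreal (W.mul_mem hw₀.1 (wordProd_mem hα l)) s
      (fun _ _ hI hJ h h' => ih hI hJ h h') hI hJ h h'

end RootConfigurations

/-! ### Generic functionals, optimal facets and the Minkowski sum -/

section Generic

variable {W : Subgroup (V ≃ₗᵢ[ℝ] V)} {S : Type*} {α : Module.Basis S ℝ V} {m : ℕ} {Q : Fin m → S}

/-- `f` does not lie on a reflecting hyperplane of `W`. -/
def IsGeneric (W : Subgroup (V ≃ₗᵢ[ℝ] V)) (f : V) : Prop := ∀ v, IsRoot W v → ⟪v, f⟫ ≠ 0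

/-- Root lengths are free, so there are infinitely many root vectors but only finitely many
reflections; one representative per element of `W` suffices. -/
theorem IsGeneric.eventually_add_smul (hfin : Finite W) {g : V} (hg : IsGeneric W g) (f : V) :
    ∀ᶠ t : ℝ in nhdsWithin 0 (Set.Ioi 0), IsGeneric W (f + t • g) := by
  have key : ∀ w : W, ∀ᶠ t : ℝ in nhdsWithin 0 (Set.Ioi 0),
      ∀ v : V, v ≠ 0 → refl v = w → ⟪v, f + t • g⟫ ≠ 0 := by
    intro w
    by_cases hw : ∃ v : V, v ≠ 0 ∧ refl v = w
    · obtain ⟨v, hv, hvw⟩ := hw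
      have h1 : ∀ᶠ t : ℝ in nhdsWithin 0 (Set.Ioi 0), ⟪v, f + t • g⟫ ≠ 0 := by
        by_cases hf : ⟪v, f⟫ = 0
        · filter_upwards [self_mem_nhdsWithin] with t ht
          rw [inner_add_right, hf, zero_add, real_inner_smul_right]
          exact mul_ne_zero (ne_of_gt ht) (hg v ⟨hv, hvw ▸ w.2⟩)
        · have hcont : Continuous fun t : ℝ => ⟪v, f + t • g⟫ := by fun_prop
          refine nhdsWithin_le_nhds (hcont.continuousAt.eventually_ne ?_)
          simpa using hf
      filter_upwards [h1] with t ht u hu huw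
      obtain ⟨c, hc, rfl⟩ := exists_smul_of_refl_eq hu (hvw.trans huw.symm)
      rw [real_inner_smul_left]
      exact mul_ne_zero hc ht
    · refine Filter.Eventually.of_forall fun t v hv hvw => absurd ⟨v, hv, hvw⟩ hw
  filter_upwards [Filter.eventually_all.2 key] with t ht v hv
  exact ht ⟨_, hv.2⟩ v hv.1 rfl

theorem eventually_inner_lt {x y f : V} (h : ⟪x, f⟫ < ⟪y, f⟫) (g : V) :
    ∀ᶠ t : ℝ in nhdsWithin 0 (Set.Ioi 0), ⟪x, f + t • g⟫ < ⟪y, f + t • g⟫ := by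
  have h1 : Continuous fun t : ℝ => ⟪x, f + t • g⟫ := by fun_prop
  have h2 : Continuous fun t : ℝ => ⟪y, f + t • g⟫ := by fun_prop
  refine nhdsWithin_le_nhds (h1.continuousAt.eventually_lt h2.continuousAt ?_)
  simpa using h

theorem inner_le_of_mem_convexHull {A : Set V} {f x : V} {c : ℝ} (h : ∀ y ∈ A, ⟪y, f⟫ ≤ c)
    (hx : x ∈ convexHull ℝ A) : ⟪x, f⟫ ≤ c := by
  have hlin : IsLinearMap ℝ fun y : V => ⟪y, f⟫ :=
    ⟨fun a b => inner_add_left a b f, fun r a => real_inner_smul_left a f r⟩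
  exact convexHull_min (t := {y | ⟪y, f⟫ ≤ c}) h (convex_halfSpace_le hlin c) hx

theorem finite_setOf_exists_eq {E ι : Type*} [Finite ι] (p : ι → Prop) (φ : ι → E) :
    {x | ∃ I, p I ∧ x = φ I}.Finite := by
  refine (Set.finite_range φ).subset ?_
  rintro x ⟨I, -, rfl⟩
  exact ⟨I, rfl⟩

variable [FiniteDimensional ℝ V]

theorem exists_isGeneric (hα : IsSimpleSystem W α) : ∃ f, IsGeneric W f := by
  obtain ⟨x, hx⟩ := exists_inner_simple_eq α (fun _ => 1)
  exact ⟨x, fun v hv => hα.chamber v hv.1 hv.2 x fun s => by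
    rw [hx, α.constr_basis]; exact one_pos⟩

/-- The group acts transitively on the chambers. -/
theorem IsGeneric.exists_chamber (hfin : Finite W) (hα : IsSimpleSystem W α) {f : V}
    (hf : IsGeneric W f) :
    ∃ w ∈ W, ∀ v, IsRoot W v → 0 < ⟪v, f⟫ → IsPos α (w⁻¹ v) := by
  have := Module.Finite.finite_basis α
  have := Fintype.ofFinite S
  obtain ⟨x, hx⟩ := exists_inner_simple_eq α (fun _ => 1)
  have hx1 : ∀ s, ⟪α s, x⟫ = 1 := fun s => by rw [hx, α.constr_basis]
  -- If `w⁻¹ f` paired negatively with some `α s`, reflecting it would raise its pairing with `x`;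
  -- the maximizer therefore lies in the open fundamental chamber.
  obtain ⟨⟨w, hw⟩, hmax⟩ := Finite.exists_max fun w : W => ⟪(w : V ≃ₗᵢ[ℝ] V)⁻¹ f, x⟫
  have hinner : ∀ v, ⟪w⁻¹ v, w⁻¹ f⟫ = ⟪v, f⟫ := fun v => (w⁻¹).inner_map_map v f
  have hpos : ∀ s, 0 < ⟪α s, w⁻¹ f⟫ := by
    intro s
    have h0 : ⟪α s, w⁻¹ f⟫ ≠ 0 := by
      have := hf _ ((isRoot_simple hα s).map hw)
      rwa [← hinner, inv_apply_self] at this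
    by_contra! hle
    have hlt := lt_of_le_of_ne hle h0
    have h1 := hmax ⟨w * refl (α s), W.mul_mem hw (hα.refl_mem s)⟩
    simp only [mul_inv_rev, refl_inv, mul_apply] at h1
    rw [refl_apply, inner_sub_left, real_inner_smul_left, hx1, mul_one] at h1
    have h2 : 2 * ⟪α s, w⁻¹ f⟫ / ‖α s‖ ^ 2 < 0 := by
      have := norm_pos_iff.2 (α.ne_zero s)
      exact div_neg_of_neg_of_pos (by linarith) (by positivity)
    linarith
  refine ⟨w, hw, fun v hv hvf => ?_⟩
  refine ((hv.map (W.inv_mem hw)).pos_or_neg hα).resolve_right fun hn => ?_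
  have h1 : 0 ≤ ⟪-(w⁻¹ v), w⁻¹ f⟫ := by
    rw [← α.sum_repr (-(w⁻¹ v)), sum_inner]
    refine Finset.sum_nonneg fun s _ => ?_
    rw [real_inner_smul_left]
    exact mul_nonneg (hn.2 s) (hpos s).le
  rw [inner_neg_left, hinner] at h1
  linarith

/-- A facet is optimal for `f` when `f` is positive on its roots. -/
def IsOptimal (α : Module.Basis S ℝ V) (Q : Fin m → S) (f : V) (I : Finset (Fin m)) : Prop :=
  ∀ i ∈ I, 0 < ⟪root α Q I i, f⟫

theorem IsOptimal.unique (hW : IsFiniteReflectionGroup W) (hα : IsSimpleSystem W α)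
    {w₀ : V ≃ₗᵢ[ℝ] V} (hw₀ : IsLongest α W w₀) (hreal : IsRealizing α Q w₀)
    {f : V} (hf : IsGeneric W f) {I J : Finset (Fin m)}
    (hI : IsFacet α Q w₀ I) (hJ : IsFacet α Q w₀ J) (h : IsOptimal α Q f I)
    (h' : IsOptimal α Q f J) : I = J := by
  obtain ⟨w, hw, hpos⟩ := hf.exists_chamber hW.finite hα
  exact RootsIn.unique hW hα hw₀ hreal hw hI hJ
    (fun i hi => hpos _ (isRoot_root hα I i) (h i hi))
    (fun i hi => hpos _ (isRoot_root hα J i) (h' i hi))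

theorem IsFacet.exists_improvement (hW : IsFiniteReflectionGroup W) (hα : IsSimpleSystem W α)
    {w₀ : V ≃ₗᵢ[ℝ] V} (hw₀ : IsLongest α W w₀) {f : V} (hf : IsGeneric W f)
    {I : Finset (Fin m)} (hI : IsFacet α Q w₀ I) (h : ¬ IsOptimal α Q f I) :
    ∃ J v, IsFacet α Q w₀ J ∧ IsRoot W v ∧
      (∀ k, ∃ d : ℝ, weightFun α Q J k = weightFun α Q I k - d • v) ∧
      (∀ k, ⟪weightFun α Q I k, f⟫ ≤ ⟪weightFun α Q J k, f⟫) ∧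
      ⟪brickVector α Q I, f⟫ < ⟪brickVector α Q J, f⟫ := by
  unfold IsOptimal at h
  push Not at h
  obtain ⟨i, hi, hle⟩ := h
  have hroot := isRoot_root (Q := Q) hα I i
  have hlt := lt_of_le_of_ne hle (hf _ hroot)
  obtain ⟨j, J, hflip⟩ := hI.exists_isFlip hW hα hw₀ hi
  obtain ⟨d, hd, ⟨k₀, hk₀⟩, heq⟩ := hflip.exists_weightFun_eq hW hα hI
  have hin : ∀ k, ⟪weightFun α Q J k, f⟫ =
      ⟪weightFun α Q I k, f⟫ + d k * -⟪root α Q I i, f⟫ := by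
    intro k
    rw [heq, inner_sub_left, real_inner_smul_left]
    ring
  have hmono : ∀ k, ⟪weightFun α Q I k, f⟫ ≤ ⟪weightFun α Q J k, f⟫ := by
    intro k
    rw [hin]
    have := mul_nonneg (hd k) (neg_nonneg.2 hle)
    linarith
  refine ⟨J, _, hflip.isFacet hI, hroot, fun k => ⟨d k, heq k⟩, hmono, ?_⟩
  rw [brickVector, brickVector, sum_inner, sum_inner]
  refine Finset.sum_lt_sum (fun k _ => hmono k) ⟨k₀, Finset.mem_univ _, ?_⟩
  rw [hin]
  have := mul_pos hk₀ (neg_pos.2 hlt)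
  linarith

/-- Improvements never lower the weight at `k`, so a facet with the best brick vector among those at
least as good as `I` at `k` admits none. -/
theorem IsFacet.exists_isOptimal (hW : IsFiniteReflectionGroup W) (hα : IsSimpleSystem W α)
    {w₀ : V ≃ₗᵢ[ℝ] V} (hw₀ : IsLongest α W w₀) {f : V} (hf : IsGeneric W f)
    {I : Finset (Fin m)} (hI : IsFacet α Q w₀ I) (k : Fin m) :
    ∃ J, IsFacet α Q w₀ J ∧ IsOptimal α Q f J ∧
      ⟪weightFun α Q I k, f⟫ ≤ ⟪weightFun α Q J k, f⟫ := by
  obtain ⟨J, ⟨hJ, hJk⟩, hmax⟩ := Set.exists_max_image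
    {J | IsFacet α Q w₀ J ∧ ⟪weightFun α Q I k, f⟫ ≤ ⟪weightFun α Q J k, f⟫}
    (fun J => ⟪brickVector α Q J, f⟫) (Set.toFinite _) ⟨I, hI, le_rfl⟩
  refine ⟨J, hJ, ?_, hJk⟩
  by_contra hopt
  obtain ⟨J', v, hJ', -, -, hmono, hlt⟩ := hJ.exists_improvement hW hα hw₀ hf hopt
  exact absurd hlt (not_lt.2 (hmax J' ⟨hJ', hJk.trans (hmono k)⟩))

/-- The optimal facet maximizes all weights simultaneously. -/
theorem IsOptimal.inner_weightFun_le (hW : IsFiniteReflectionGroup W) (hα : IsSimpleSystem W α)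
    {w₀ : V ≃ₗᵢ[ℝ] V} (hw₀ : IsLongest α W w₀) (hreal : IsRealizing α Q w₀)
    {f : V} (hf : IsGeneric W f) {M I : Finset (Fin m)} (hM : IsFacet α Q w₀ M)
    (hopt : IsOptimal α Q f M) (hI : IsFacet α Q w₀ I) (k : Fin m) :
    ⟪weightFun α Q I k, f⟫ ≤ ⟪weightFun α Q M k, f⟫ := by
  obtain ⟨J, hJ, hJopt, hle⟩ := hI.exists_isOptimal hW hα hw₀ hf k
  rwa [IsOptimal.unique hW hα hw₀ hreal hf hJ hM hJopt hopt] at hle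

theorem exists_inner_eq (l : V →L[ℝ] ℝ) : ∃ f : V, ∀ x, l x = ⟪x, f⟫ := by
  have := FiniteDimensional.complete ℝ V
  refine ⟨(InnerProductSpace.toDual ℝ V).symm l, fun x => ?_⟩
  rw [real_inner_comm, InnerProductSpace.toDual_symm_apply]

theorem brickPolytope_eq_sum (hW : IsFiniteReflectionGroup W) (hα : IsSimpleSystem W α)
    {w₀ : V ≃ₗᵢ[ℝ] V} (hw₀ : IsLongest α W w₀) (hreal : IsRealizing α Q w₀)
    (hne : ∃ I, IsFacet α Q w₀ I) :
    brickPolytope α Q w₀ = ∑ k, brickSummand α Q w₀ k := by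
  refine Set.Subset.antisymm ?_ fun x hx => ?_
  · refine convexHull_min ?_ ?_
    · rintro x ⟨I, hI, rfl⟩
      exact Set.finsetSum_mem_finsetSum _ _ _ fun k _ => subset_convexHull ℝ _ ⟨I, hI, rfl⟩
    · simp only [brickSummand]
      rw [← convexHull_sum]
      exact convex_convexHull ℝ _
  · by_contra hnot
    obtain ⟨l, u, hl, hu⟩ := geometric_hahn_banach_closed_point (convex_convexHull ℝ _)
      ((finite_setOf_exists_eq _ _).isClosed_convexHull ℝ) hnot
    obtain ⟨f, hf⟩ := exists_inner_eq l
    obtain ⟨g, hg⟩ := exists_isGeneric hα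
    -- Strict separation from finitely many brick vectors survives a small shift along `g`, which
    -- makes the functional generic.
    have h1 : ∀ᶠ t : ℝ in nhdsWithin 0 (Set.Ioi 0), ∀ I : Finset (Fin m), IsFacet α Q w₀ I →
        ⟪brickVector α Q I, f + t • g⟫ < ⟪x, f + t • g⟫ := by
      refine Filter.eventually_all.2 fun I => ?_
      by_cases hI : IsFacet α Q w₀ I
      · have h2 := (hl _ (subset_convexHull ℝ _ ⟨I, hI, rfl⟩)).trans hu
        rw [hf, hf] at h2
        filter_upwards [eventually_inner_lt h2 g] with t ht _ using ht
      · exact Filter.Eventually.of_forall fun t h => absurd h hI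
    obtain ⟨t, ht1, ht2⟩ := (h1.and (hg.eventually_add_smul hW.finite f)).exists
    obtain ⟨M, hM, hopt⟩ : ∃ M, IsFacet α Q w₀ M ∧ IsOptimal α Q (f + t • g) M := by
      obtain ⟨I, hI⟩ := hne
      obtain ⟨M, hM, hmax⟩ := Set.exists_max_image {J | IsFacet α Q w₀ J}
        (fun J => ⟪brickVector α Q J, f + t • g⟫) (Set.toFinite _) ⟨I, hI⟩
      refine ⟨M, hM, ?_⟩
      by_contra hopt
      obtain ⟨J, v, hJ, -, -, -, hlt⟩ := hM.exists_improvement hW hα hw₀ ht2 hopt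
      exact absurd hlt (not_lt.2 (hmax J hJ))
    obtain ⟨y, hy, rfl⟩ := (Set.mem_fintype_sum _ _).1 hx
    refine absurd (ht1 M hM) (not_lt.2 ?_)
    rw [brickVector, sum_inner, sum_inner]
    refine Finset.sum_le_sum fun k _ => inner_le_of_mem_convexHull ?_ (hy k)
    rintro z ⟨I, hI, rfl⟩
    exact hopt.inner_weightFun_le hW hα hw₀ hreal ht2 hM hI k

end Generic

/-! ### Edges of the summands and their mirror symmetries -/

section Edges

theorem left_mem_extremePoints_segment (a b : V) : a ∈ (segment ℝ a b).extremePoints ℝ := by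
  rw [mem_extremePoints_iff_left]
  refine ⟨left_mem_segment ℝ a b, fun x hx y hy hxy => ?_⟩
  rw [segment_eq_image'] at hx hy
  obtain ⟨s, ⟨hs, -⟩, rfl⟩ := hx
  obtain ⟨t, ⟨ht, -⟩, rfl⟩ := hy
  obtain ⟨p, q, hp, hq, hpq, h⟩ := hxy
  have h0 : (p * s + q * t) • (b - a) = 0 := by
    have h1 : p • (a + s • (b - a)) + q • (a + t • (b - a)) =
        (p + q) • a + (p * s + q * t) • (b - a) := by module
    rw [h1, hpq, one_smul] at h
    simpa using h
  rcases smul_eq_zero.1 h0 with h1 | h1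
  · have h2 := mul_nonneg hp.le hs
    have h3 := mul_nonneg hq.le ht
    have h4 : p * s = 0 := by linarith
    rw [(mul_eq_zero.1 h4).resolve_left hp.ne']
    simp
  · simp [h1]

variable [FiniteDimensional ℝ V]

/-- Equal norms put the origin on the perpendicular bisector, so the affine reflection is linear. -/
theorem mirror_eq {a b : V} (h : ‖a‖ = ‖b‖) :
    mirror a b = (refl (b - a)).toAffineIsometryEquiv := by
  ext x
  have h0 : (0 : V) ∈ AffineSubspace.perpBisector a b := by
    rw [AffineSubspace.mem_perpBisector_iff_dist_eq]
    simpa using h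
  have : Nonempty (AffineSubspace.perpBisector a b) := ⟨⟨0, h0⟩⟩
  rw [mirror, EuclideanGeometry.reflection_apply_of_mem _ _ h0]
  simp [refl, AffineSubspace.direction_perpBisector]

variable {W : Subgroup (V ≃ₗᵢ[ℝ] V)} {S : Type*} {α : Module.Basis S ℝ V} {m : ℕ} {Q : Fin m → S}

theorem IsEdge.exists_weightFun_eq {ρ : V ≃ₗᵢ[ℝ] V} {k : Fin m} {a b : V}
    (h : IsEdge (brickSummand α Q ρ k) a b) :
    (∃ I, IsFacet α Q ρ I ∧ a = weightFun α Q I k) ∧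
      ∃ I, IsFacet α Q ρ I ∧ b = weightFun α Q I k := by
  have hsub := h.2.isExtreme.extremePoints_subset_extremePoints
  have hext : ∀ x ∈ (brickSummand α Q ρ k).extremePoints ℝ,
      ∃ I, IsFacet α Q ρ I ∧ x = weightFun α Q I k :=
    fun x hx => extremePoints_convexHull_subset
      (A := {x | ∃ I, IsFacet α Q ρ I ∧ x = weightFun α Q I k}) hx
  refine ⟨hext a (hsub (left_mem_extremePoints_segment a b)), hext b ?_⟩
  have := left_mem_extremePoints_segment b a
  rw [segment_symm] at this
  exact hsub this

theorem norm_weightFun (I : Finset (Fin m)) (k : Fin m) :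
    ‖weightFun α Q I k‖ = ‖weight α (Q k)‖ := by
  rw [weightFun_eq, LinearIsometryEquiv.norm_map]

/-- The edges of the summands are parallel to roots. -/
theorem IsEdge.refl_mem (hW : IsFiniteReflectionGroup W) (hα : IsSimpleSystem W α)
    {w₀ : V ≃ₗᵢ[ℝ] V} (hw₀ : IsLongest α W w₀) (hreal : IsRealizing α Q w₀)
    {k : Fin m} {a b : V} (h : IsEdge (brickSummand α Q w₀ k) a b) : refl (b - a) ∈ W := by
  obtain ⟨⟨A, hA, rfl⟩, B, hB, rfl⟩ := h.exists_weightFun_eq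
  obtain ⟨hab, hexp⟩ := h
  obtain ⟨l, hl⟩ := hexp ⟨_, left_mem_segment ℝ _ _⟩
  obtain ⟨f, hf⟩ := exists_inner_eq l
  have hmemP : ∀ J, IsFacet α Q w₀ J → weightFun α Q J k ∈ brickSummand α Q w₀ k :=
    fun J hJ => subset_convexHull ℝ _ ⟨J, hJ, rfl⟩
  have ha := left_mem_segment ℝ (weightFun α Q A k) (weightFun α Q B k)
  have hb := right_mem_segment ℝ (weightFun α Q A k) (weightFun α Q B k)
  rw [hl] at ha hb
  have hle : ∀ J, IsFacet α Q w₀ J → ⟪weightFun α Q J k, f⟫ ≤ ⟪weightFun α Q A k, f⟫ := by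
    intro J hJ
    rw [← hf, ← hf]
    exact ha.2 _ (hmemP J hJ)
  have hseg : ∀ J, IsFacet α Q w₀ J → ⟪weightFun α Q A k, f⟫ ≤ ⟪weightFun α Q J k, f⟫ →
      weightFun α Q J k ∈ segment ℝ (weightFun α Q A k) (weightFun α Q B k) := by
    intro J hJ h1
    rw [hl]
    refine ⟨hmemP J hJ, fun y hy => (ha.2 y hy).trans ?_⟩
    rw [hf, hf]
    exact h1
  have hfab : ⟪weightFun α Q A k, f⟫ = ⟪weightFun α Q B k, f⟫ := by
    refine le_antisymm ?_ (hle B hB)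
    rw [← hf, ← hf]
    exact hb.2 _ (hmemP A hA)
  obtain ⟨ρ, hρ⟩ := exists_isGeneric hα
  have hab' : ⟪weightFun α Q A k, weightFun α Q B k - weightFun α Q A k⟫ <
      ⟪weightFun α Q B k, weightFun α Q B k - weightFun α Q A k⟫ := by
    rw [← sub_pos, ← inner_sub_left]
    exact real_inner_self_pos.2 (sub_ne_zero.2 hab.symm)
  -- The direction `b - a` prefers `b` strictly; a small multiple of `ρ` makes it generic without
  -- losing this.
  obtain ⟨t, ht1, ht2⟩ := ((eventually_inner_lt hab' ρ).and
    (hρ.eventually_add_smul hW.finite (weightFun α Q B k - weightFun α Q A k))).exists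
  set g := weightFun α Q B k - weightFun α Q A k + t • ρ with hg
  -- For small `ε`, facets with weight off the edge remain strictly below `a`.
  have hlt : ∀ᶠ ε : ℝ in nhdsWithin 0 (Set.Ioi 0), ∀ J : Finset (Fin m),
      ⟪weightFun α Q J k, f⟫ < ⟪weightFun α Q A k, f⟫ →
        ⟪weightFun α Q J k, f + ε • g⟫ < ⟪weightFun α Q A k, f + ε • g⟫ := by
    refine Filter.eventually_all.2 fun J => ?_
    by_cases hJ : ⟪weightFun α Q J k, f⟫ < ⟪weightFun α Q A k, f⟫
    · filter_upwards [eventually_inner_lt hJ g] with ε hε _ using hε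
    · exact Filter.Eventually.of_forall fun ε h' => absurd h' hJ
  obtain ⟨ε, ⟨hε1, hε2⟩, hε0⟩ :=
    ((hlt.and (ht2.eventually_add_smul hW.finite f)).and self_mem_nhdsWithin).exists
  have hε0 : 0 < ε := hε0
  have hBA : ⟪weightFun α Q A k, f + ε • g⟫ < ⟪weightFun α Q B k, f + ε • g⟫ := by
    rw [inner_add_right, inner_add_right, hfab, real_inner_smul_right, real_inner_smul_right]
    have := mul_lt_mul_of_pos_left ht1 hε0
    linarith
  -- With the best brick vector among facets of weight `a`, any improvement of `J` must change the
  -- weight at `k`.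
  obtain ⟨J, ⟨hJ, hJA⟩, hmax⟩ := Set.exists_max_image
    {J | IsFacet α Q w₀ J ∧ weightFun α Q J k = weightFun α Q A k}
    (fun J => ⟪brickVector α Q J, f + ε • g⟫) (Set.toFinite _) ⟨A, hA, rfl⟩
  have hJopt : ¬ IsOptimal α Q (f + ε • g) J := fun hopt => by
    have := hopt.inner_weightFun_le hW hα hw₀ hreal hε2 hJ hB k
    rw [hJA] at this
    exact absurd hBA (not_lt.2 this)
  obtain ⟨J', v, hJ', hv, hd, hmono, himp⟩ := hJ.exists_improvement hW hα hw₀ hε2 hJopt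
  obtain ⟨d, hd⟩ := hd k
  have hne : weightFun α Q J' k ≠ weightFun α Q A k := fun e =>
    absurd himp (not_lt.2 (hmax J' ⟨hJ', e⟩))
  -- Off the edge, the new weight would lie below `a` for the perturbed functional, but an
  -- improvement never decreases it.
  have hmem := hseg J' hJ' (by
    by_contra! h1
    have h2 := hmono k
    rw [hJA] at h2
    exact absurd (hε1 J' h1) (not_lt.2 h2))
  rw [segment_eq_image'] at hmem
  obtain ⟨θ, -, hθ⟩ := hmem
  have hθ0 : θ ≠ 0 := by
    rintro rfl
    exact hne (by simpa using hθ.symm)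
  have heq : θ • (weightFun α Q B k - weightFun α Q A k) = (-d) • v := by
    rw [hd, hJA] at hθ
    simp only at hθ
    rw [neg_smul, ← add_right_inj (weightFun α Q A k), hθ, sub_eq_add_neg]
  have hd0 : -d ≠ 0 := by
    intro h0
    rw [h0, zero_smul] at heq
    exact (smul_ne_zero hθ0 (sub_ne_zero.2 hab.symm)) heq
  rw [← refl_smul hθ0, heq, refl_smul hd0]
  exact hv.2

theorem isMatroidPolytope_brickSummand (hW : IsFiniteReflectionGroup W)
    (hα : IsSimpleSystem W α) {w₀ : V ≃ₗᵢ[ℝ] V} (hw₀ : IsLongest α W w₀)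
    (hreal : IsRealizing α Q w₀) (hne : ∃ I, IsFacet α Q w₀ I) (k : Fin m) :
    IsMatroidPolytope W (brickSummand α Q w₀ k) := by
  refine ⟨⟨(finite_setOf_exists_eq (IsFacet α Q w₀) fun I => weightFun α Q I k).toFinset, ?_, ?_⟩, fun g hg => ?_⟩
  · obtain ⟨I, hI⟩ := hne
    exact ⟨weightFun α Q I k, by simpa using ⟨I, hI, rfl⟩⟩
  · rw [Set.Finite.coe_toFinset, brickSummand]
  · induction hg using Subgroup.closure_induction with
    | mem g hg =>
      obtain ⟨a, b, hab, rfl⟩ := hg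
      refine ⟨_, hab.refl_mem hW hα hw₀ hreal, mirror_eq ?_⟩
      obtain ⟨⟨A, -, rfl⟩, B, -, rfl⟩ := hab.exists_weightFun_eq
      rw [norm_weightFun, norm_weightFun]
    | one => exact ⟨1, W.one_mem, rfl⟩
    | mul g h _ _ ihg ihh =>
      obtain ⟨w, hw, rfl⟩ := ihg
      obtain ⟨w', hw', rfl⟩ := ihh
      exact ⟨w * w', W.mul_mem hw hw', rfl⟩
    | inv g _ ih =>
      obtain ⟨w, hw, rfl⟩ := ih
      exact ⟨w⁻¹, W.inv_mem hw, rfl⟩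

end Edges

end BrickPolytope

theorem mainTheorem5 {V : Type*} [NormedAddCommGroup V] [InnerProductSpace ℝ V]
    [FiniteDimensional ℝ V] {S : Type*} (W : Subgroup (V ≃ₗᵢ[ℝ] V))
    (hW : BrickPolytope.IsFiniteReflectionGroup W)
    (α : Module.Basis S ℝ V) (hα : BrickPolytope.IsSimpleSystem W α)
    (w₀ : V ≃ₗᵢ[ℝ] V) (hw₀ : BrickPolytope.IsLongest α W w₀)
    {m : ℕ} (Q : Fin m → S) (hQ : BrickPolytope.demazure α (List.ofFn Q) = w₀)
    (hreal : BrickPolytope.IsRealizing α Q w₀) :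
    BrickPolytope.brickPolytope α Q w₀ = ∑ k, BrickPolytope.brickSummand α Q w₀ k ∧
      ∀ k, BrickPolytope.IsMatroidPolytope W (BrickPolytope.brickSummand α Q w₀ k) := by
  have hne : ∃ I, BrickPolytope.IsFacet α Q w₀ I := hQ ▸ BrickPolytope.exists_isFacet_demazure
  exact ⟨BrickPolytope.brickPolytope_eq_sum hW hα hw₀ hreal hne,
    BrickPolytope.isMatroidPolytope_brickSummand hW hα hw₀ hreal hne⟩
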